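/- Let $AP$ be a finite non-empty set of atomic propositions. A Markov chain (MC) over $AP$ has a countable state space, a transition function mapping states to distributions over states, a labelling of states by subsets of $AP$, and an initial state; PCTL formulas $a\mid\Phi\wedge\Psi\mid\neg\Phi\mid P_{\bowtie q}(\mathsf X\Phi)\mid P_{\bowtie q}(\Phi\,\mathsf U\,\Psi)\mid P_{\bowtie q}(\Phi\,\mathsf W\,\Psi)$ ($\bowtie\in\{<,>,\le,\ge\}$, $q\in[0,1]$; $\mathsf X$ next, $\mathsf U$ until, $\mathsf W$ weak until) have their usual semantics over MCs, and $\Phi\equiv\Psi$ means that the same MCs satisfy $\Phi$ and $\Psi$. A probabilistic tree is a tree of non-empty sequences of natural numbers with a single root, whose nodes are labelled by subsets of $AP$ and in which each non-leaf carries a distribution whose support is the set of its children; it is total if it has no leaves, and of finite depth if the lengths of its nodes are bounded. $T_1$ is a prefix of $T_2$ ($T_1\preceq T_2$) if the nodes of $T_1$ are nodes of $T_2$ and labels and edge probabilities agree on the nodes of $T_1$. A property is a set of total trees. The property of a PCTL formula $\Phi$, also written $\Phi$, is the set of the unfoldings (up to renaming of nodes) of the MCs that satisfy $\Phi$. For a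 property $P$ let $\mathit{cls}(P)$ be the set of total trees $T$ such that each finite-depth prefix of $T$ is a prefix of some tree in $P$. $P$ is safe if $\mathit{cls}(P)=P$, and live if every finite-depth tree is a prefix of a tree in $P$. Literal formulas are $\alpha::=a\mid\neg\alpha\mid\alpha\wedge\alpha$; flat formulas are $\Phi::=P_{\bowtie q}(\mathsf X\alpha)\mid P_{\bowtie q}(\alpha\,\mathsf U\,\beta)\mid P_{\bowtie q}(\alpha\,\mathsf W\,\beta)\mid\Phi\wedge\Phi\mid\Phi\vee\Phi$ with $\bowtie\in\{\le,\ge\}$, $q\in[0,1]$ and $\alpha,\beta$ literal formulas. A clause is a flat formula without conjunctions outside literal formulas. A literal formula is satisfiable (valid) if some (every) subset of $AP$ satisfies it. **Theorem.** 1. For all literal formulas $\alpha,\beta$ and $q\in[0,1]$: - $\mathit{cls}(\alpha)=\alpha$, and $\mathit{cls}(P_{\bowtie q}(\mathsf X\alpha))=P_{\bowtie q}(\mathsf X\alpha)$ for $\bowtie\in\{\le,\ge\}$; - $\mathit{cls}(P_{\le q}(\alpha\,\mathsf U\,\beta))=P_{\le q}(\alpha\,\mathsf U\,\beta)$; - $\mathit{cls}(P_{\ge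 q}(\alpha\,\mathsf U\,\beta))=P_{\ge q}(\alpha\,\mathsf W\,\beta)$, provided that $\beta$ is satisfiable (or $q=0$, or $\alpha$ is unsatisfiable); - $\mathit{cls}(P_{\ge q}(\alpha\,\mathsf W\,\beta))=P_{\ge q}(\alpha\,\mathsf W\,\beta)$; - $\mathit{cls}(P_{\le q}(\alpha\,\mathsf W\,\beta))=P_{\le q}(\alpha\,\mathsf U\,\beta)$, provided that $\neg\alpha\wedge\neg\beta$ is satisfiable (or $q=1$, or $\beta$ is valid); - $\mathit{cls}(\Phi\vee\Psi)=\mathit{cls}(\Phi)\cup\mathit{cls}(\Psi)$ for all PCTL formulas $\Phi,\Psi$. 2. The closure of the property of a clause is the property of a clause. 3. Consider the algorithm that, given a flat formula $\Phi$, rewrites $\Phi$ by distributivity into a conjunction $\Phi_1\wedge\dots\wedge\Phi_n$ of clauses and returns $\Phi^s=\bigwedge_i\Phi_i^s$ and $\Phi^l=\bigwedge_i(\Phi_i\vee\neg\Phi_i^s)$, where $\Phi_i^s$ is obtained from $\Phi_i$ by replacing each $P_{\ge q}(\alpha\,\mathsf U\,\beta)$ by $P_{\ge q}(\alpha\,\mathsf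 W\,\beta)$ and each $P_{\le q}(\alpha\,\mathsf W\,\beta)$ by $P_{\le q}(\alpha\,\mathsf U\,\beta)$. Then $\Phi^s$ is flat, $\Phi\equiv\Phi^s\wedge\Phi^l$, and $\Phi^s$ is safe. Moreover, $\Phi^l$ is live, provided that $\Phi$ has no subformula $P_{\ge q}(\alpha\,\mathsf U\,\beta)$ with $q>0$ and no subformula $P_{\le q}(\alpha\,\mathsf W\,\beta)$ with $q<1$ in which $\alpha$ is valid and $\beta$ is unsatisfiable. 4. For every flat formula $\Phi$ without exception there are a flat formula $\Phi^s$ and a PCTL formula $\Phi^l$ with $\Phi\equiv\Phi^s\wedge\Phi^l$, $\Phi^s$ safe and $\Phi^l$ live. -/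

import Mathlib

open scoped ENNReal

namespace ProbLogic

noncomputable section

/-! ### Markov chains -/

/-- A discrete-time Markov chain with state space `S` (countable wherever it is used) over the
atomic propositions `AP`. -/
structure MarkovChain (S AP : Type*) where
  /-- the transition function, mapping a state to a distribution over states -/
  trans : S → PMF S
  /-- the labelling function -/
  label : S → Set AP
  /-- the initial state -/
  init : S

namespace MarkovChain

variable {S AP : Type*}

section Paths

variable [MeasurableSpace S] [DiscreteMeasurableSpace S]

/-- The transition at time `n`: given `π 0, …, π n`, the next state has the distribution
`D.trans (π n)`. -/
def stepKernel (D : MarkovChain S AP) (n : ℕ) :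
    ProbabilityTheory.Kernel ((_i : Finset.Iic n) → S) S where
  toFun x := (D.trans (x ⟨n, Finset.mem_Iic.2 le_rfl⟩)).toMeasure
  measurable' :=
    (Measurable.of_discrete (f := fun s : S => (D.trans s).toMeasure)).comp
      (measurable_pi_apply (⟨n, Finset.mem_Iic.2 le_rfl⟩ : Finset.Iic n))

instance (D : MarkovChain S AP) (n : ℕ) :
    ProbabilityTheory.IsMarkovKernel (D.stepKernel n) :=
  ⟨fun x => PMF.toMeasure.isProbabilityMeasure (D.trans (x ⟨n, Finset.mem_Iic.2 le_rfl⟩))⟩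

/-- The law of the infinite path of the chain started in `s` (Ionescu-Tulcea), on the σ-algebra
generated by the cylinder sets. -/
def pathMeasure (D : MarkovChain S AP) (s : S) : MeasureTheory.Measure (ℕ → S) :=
  ProbabilityTheory.Kernel.traj (X := fun _ => S) D.stepKernel 0 (fun _ => s)

end Paths

/-- The probability that the path of the chain started in `s` lies in `A`; all sets of states
count as measurable. -/
def pr (D : MarkovChain S AP) (s : S) (A : Set (ℕ → S)) : ℝ :=
  letI : MeasurableSpace S := ⊤
  (D.pathMeasure s).real A

end MarkovChain

/-! ### PCTL -/

/-- The comparison operators `<`, `>`, `≤`, `≥`. -/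
inductive Cmp
  | lt | gt | le | ge

/-- `c.Holds x q` means `x ⋈ q`, where `c` is `⋈`. -/
def Cmp.Holds : Cmp → ℝ → ℝ → Prop
  | .lt, x, q => x < q
  | .gt, x, q => x > q
  | .le, x, q => x ≤ q
  | .ge, x, q => x ≥ q

/-- PCTL state formulas; `probX c q Φ`, `probU c q Φ Ψ`, `probW c q Φ Ψ` are
`P_{⋈ q}(X Φ)`, `P_{⋈ q}(Φ U Ψ)`, `P_{⋈ q}(Φ W Ψ)`. -/
inductive PCTL (AP : Type*)
  | atom (a : AP) : PCTL AP
  | and (Φ Ψ : PCTL AP) : PCTL AP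
  | neg (Φ : PCTL AP) : PCTL AP
  | probX (c : Cmp) (q : unitInterval) (Φ : PCTL AP) : PCTL AP
  | probU (c : Cmp) (q : unitInterval) (Φ Ψ : PCTL AP) : PCTL AP
  | probW (c : Cmp) (q : unitInterval) (Φ Ψ : PCTL AP) : PCTL AP

/-- The paths that satisfy `X A`, for a set `A` of states. -/
def nextPaths {S : Type*} (A : S → Prop) : Set (ℕ → S) :=
  {π | A (π 1)}

/-- The paths that satisfy `A U B`, for sets `A`, `B` of states. -/
def untilPaths {S : Type*} (A B : S → Prop) : Set (ℕ → S) :=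
  {π | ∃ j, B (π j) ∧ ∀ k < j, A (π k)}

/-- The paths that satisfy `A W B`, for sets `A`, `B` of states. -/
def weakUntilPaths {S : Type*} (A B : S → Prop) : Set (ℕ → S) :=
  {π | π ∈ untilPaths A B ∨ ∀ i, A (π i)}

namespace PCTL

variable {AP : Type*}

/-- Disjunction, as the usual abbreviation. -/
def or (Φ Ψ : PCTL AP) : PCTL AP :=
  neg (and (neg Φ) (neg Ψ))

/-- The satisfaction relation `s ⊨ Φ` in a Markov chain. -/
def Sat {S : Type*} (D : MarkovChain S AP) : PCTL AP → S → Prop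
  | atom a, s => a ∈ D.label s
  | and Φ Ψ, s => Φ.Sat D s ∧ Ψ.Sat D s
  | neg Φ, s => ¬ Φ.Sat D s
  | probX c q Φ, s => c.Holds (D.pr s (nextPaths (Φ.Sat D))) q
  | probU c q Φ Ψ, s => c.Holds (D.pr s (untilPaths (Φ.Sat D) (Ψ.Sat D))) q
  | probW c q Φ Ψ, s => c.Holds (D.pr s (weakUntilPaths (Φ.Sat D) (Ψ.Sat D))) q

/-- `Φ ≡ Ψ`: the two formulas are satisfied by the same Markov chains. -/
def Equivalent (Φ Ψ : PCTL AP) : Prop :=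
  ∀ (S : Type) [Countable S] (D : MarkovChain S AP), Φ.Sat D D.init ↔ Ψ.Sat D D.init

end PCTL

/-! ### Probabilistic trees -/

/-- A probabilistic tree. The nodes are nonempty sequences of natural numbers; the root is the
only node of length one. The partial edge labelling function is encoded by the total function
`prob`: it is undefined at a node (the node is a leaf) iff the node has no child, and then
`prob` is zero there; otherwise it is a distribution whose support is the set of children.
Outside the nodes, `label` and `prob` have the default values `∅` and `0`. -/
@[ext]
structure ProbTree (AP : Type*) where
  /-- the set of nodes -/
  nodes : Set (List ℕ)
  /-- the node labelling function -/
  label : List ℕ → Set AP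
  /-- the edge labelling function -/
  prob : List ℕ → List ℕ → ℝ≥0∞
  nil_notMem : [] ∉ nodes
  existsUnique_root : ∃! n, [n] ∈ nodes
  prefix_closed : ∀ π ∈ nodes, ∀ π', π' <+: π → π' ≠ [] → π' ∈ nodes
  label_of_notMem : ∀ π, π ∉ nodes → label π = ∅
  prob_pos_iff : ∀ π π', 0 < prob π π' ↔ π ∈ nodes ∧ π' ∈ nodes ∧ ∃ n, π' = π ++ [n]
  tsum_prob : ∀ π ∈ nodes, (∃ n, π ++ [n] ∈ nodes) → ∑' π', prob π π' = 1

namespace ProbTree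

variable {AP : Type*}

/-- Every node has a proper extension. -/
def IsTotal (T : ProbTree AP) : Prop :=
  ∀ π ∈ T.nodes, ∃ π' ∈ T.nodes, π <+: π' ∧ π ≠ π'

/-- The depth of the nodes is bounded. -/
def IsFiniteDepth (T : ProbTree AP) : Prop :=
  ∃ n, ∀ π ∈ T.nodes, π.length ≤ n

/-- The prefix relation between probabilistic trees. -/
def IsPrefix (T₁ T₂ : ProbTree AP) : Prop :=
  T₁.nodes ⊆ T₂.nodes ∧ (∀ π ∈ T₁.nodes, T₂.label π = T₁.label π) ∧
    ∀ π ∈ T₁.nodes, ∀ π' ∈ T₁.nodes, T₂.prob π π' = T₁.prob π π'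

/-- Equality of probabilistic trees up to a renaming of the nodes. As `prob` is positive exactly
between a node and its children, such a renaming preserves the tree structure and the root. -/
def Isomorphic (T₁ T₂ : ProbTree AP) : Prop :=
  ∃ f : T₁.nodes ≃ T₂.nodes, (∀ π, T₂.label (f π) = T₁.label π) ∧
    ∀ π π', T₂.prob (f π) (f π') = T₁.prob π π'

end ProbTree

/-- The total probabilistic trees. -/
abbrev TotalTree (AP : Type*) := {T : ProbTree AP // T.IsTotal}

/-! ### The unfolding of a Markov chain -/

namespace MarkovChain

variable {AP : Type*}

/-- The nodes of the unfolding: the finite sequences of states that start in the initial state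
and along which all transitions have positive probability. -/
inductive IsRun (D : MarkovChain ℕ AP) : List ℕ → Prop
  | init : IsRun D [D.init]
  | step (π : List ℕ) (t : ℕ) : IsRun D π → t ∈ (D.trans (π.getLastD D.init)).support →
      IsRun D (π ++ [t])

theorem IsRun.ne_nil {D : MarkovChain ℕ AP} {π : List ℕ} (h : D.IsRun π) : π ≠ [] := by
  cases h <;> simp

theorem IsRun.singleton {D : MarkovChain ℕ AP} {n : ℕ} (h : D.IsRun [n]) : n = D.init := by
  generalize hl : [n] = l at h
  cases h with
  | init => simpa using hl
  | step π t hπ _ =>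
    have h0 := hπ.ne_nil
    have h1 := congrArg List.length hl
    have h2 := List.length_pos_iff.2 h0
    simp at h1
    exact absurd h1 h0

theorem IsRun.mem_support {D : MarkovChain ℕ AP} {π : List ℕ} {t : ℕ} (h0 : π ≠ [])
    (h : D.IsRun (π ++ [t])) : t ∈ (D.trans (π.getLastD D.init)).support := by
  generalize hl : π ++ [t] = l at h
  cases h with
  | init =>
    have h1 := congrArg List.length hl
    simp at h1
    exact absurd h1 h0
  | step π' t' _ ht =>
    obtain ⟨rfl, h2⟩ := List.append_inj' hl rfl
    obtain rfl : t = t' := by simpa using h2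
    exact ht

theorem IsRun.of_prefix {D : MarkovChain ℕ AP} {π π' : List ℕ} (h : D.IsRun π)
    (hp : π' <+: π) (h0 : π' ≠ []) : D.IsRun π' := by
  induction h with
  | init =>
    have : π' = [D.init] := by
      rcases List.prefix_concat_iff (l₂ := []).1 (by simpa using hp) with h1 | h1
      · simpa using h1
      · exact absurd (List.prefix_nil.1 h1) h0
    rw [this]
    exact IsRun.init
  | step π t hπ ht ih =>
    rcases List.prefix_concat_iff.1 hp with rfl | h1
    · exact IsRun.step π t hπ ht
    · exact ih h1

open Classical in
/-- The unfolding of a Markov chain whose states are natural numbers: a node is a finite run of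
the chain, labelled as its last state, and the edge from `π` to `π ++ [t]` has the probability of
the transition from the last state of `π` to `t`. -/
def unfolding (D : MarkovChain ℕ AP) : ProbTree AP where
  nodes := {π | D.IsRun π}
  label π := if D.IsRun π then D.label (π.getLastD D.init) else ∅
  prob π π' :=
    if D.IsRun π ∧ ∃ t, π' = π ++ [t] then
      D.trans (π.getLastD D.init) (π'.getLastD D.init)
    else 0
  nil_notMem h := h.ne_nil rfl
  existsUnique_root := ⟨D.init, IsRun.init, fun _ h => IsRun.singleton h⟩
  prefix_closed _ h _ hp h0 := IsRun.of_prefix h hp h0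
  label_of_notMem _ h := if_neg h
  prob_pos_iff π π' := by
    constructor
    · intro h
      split_ifs at h with hc
      · obtain ⟨hπ, t, rfl⟩ := hc
        refine ⟨hπ, IsRun.step π t hπ ?_, t, rfl⟩
        rw [PMF.mem_support_iff]
        simpa [pos_iff_ne_zero] using h
      · simp at h
    · rintro ⟨hπ, hπ', t, rfl⟩
      rw [if_pos ⟨hπ, t, rfl⟩, pos_iff_ne_zero]
      have h1 := IsRun.mem_support (IsRun.ne_nil hπ) hπ'
      rw [PMF.mem_support_iff] at h1
      simpa using h1
  tsum_prob π hπ _ := by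
    have hinj : Function.Injective (fun t : ℕ => π ++ [t]) := by
      intro s t h
      simpa using h
    rw [← hinj.tsum_eq]
    · rw [← (D.trans (π.getLastD D.init)).tsum_coe]
      refine tsum_congr fun t => ?_
      rw [if_pos ⟨hπ, t, rfl⟩]
      simp
    · intro π' h
      by_contra hc
      refine h (if_neg ?_)
      rintro ⟨_, t, rfl⟩
      exact hc ⟨t, rfl⟩

end MarkovChain

/-! ### Properties, closure, safety, liveness -/

section Properties

variable {AP : Type*}

/-- The property that corresponds to a PCTL formula: the unfoldings of the Markov chains that
satisfy it, where the names of the nodes of a tree are irrelevant. -/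
def PCTL.property (Φ : PCTL AP) : Set (TotalTree AP) :=
  {T | ∃ D : MarkovChain ℕ AP, Φ.Sat D D.init ∧ T.1.Isomorphic D.unfolding}

/-- The finite-depth prefixes of a tree. -/
def finPrefixes (T : ProbTree AP) : Set (ProbTree AP) :=
  {T₁ | T₁.IsFiniteDepth ∧ T₁.IsPrefix T}

/-- The closure of a property. -/
def propertyClosure (P : Set (TotalTree AP)) : Set (TotalTree AP) :=
  {T | ∀ T₁ ∈ finPrefixes T.1, ∃ T₂ ∈ P, T₁.IsPrefix T₂.1}

/-- Safety properties. -/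
def IsSafe (P : Set (TotalTree AP)) : Prop :=
  ∀ T : TotalTree AP, T ∈ P ↔ ∀ T₁ ∈ finPrefixes T.1, ∃ T₂ ∈ P, T₁.IsPrefix T₂.1

/-- Liveness properties. -/
def IsLive (P : Set (TotalTree AP)) : Prop :=
  ∀ T₁ : ProbTree AP, T₁.IsFiniteDepth → ∃ T₂ ∈ P, T₁.IsPrefix T₂.1

end Properties

/-! ### Flat PCTL -/

/-- Literal formulas: `a`, `¬ α`, `α ∧ β`. -/
inductive Literal (AP : Type*)
  | atom (a : AP) : Literal AP
  | neg (α : Literal AP) : Literal AP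
  | and (α β : Literal AP) : Literal AP

namespace Literal

variable {AP : Type*}

/-- A literal formula as a PCTL formula. -/
def toPCTL : Literal AP → PCTL AP
  | atom a => .atom a
  | neg α => .neg α.toPCTL
  | and α β => .and α.toPCTL β.toPCTL

/-- Truth of a literal formula at a state with label `A`. -/
def HoldsAt (A : Set AP) : Literal AP → Prop
  | atom a => a ∈ A
  | neg α => ¬ α.HoldsAt A
  | and α β => α.HoldsAt A ∧ β.HoldsAt A

/-- Some label satisfies the literal formula. -/
def Satisfiable (α : Literal AP) : Prop :=
  ∃ A : Set AP, α.HoldsAt A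

/-- Every label satisfies the literal formula. -/
def Valid (α : Literal AP) : Prop :=
  ∀ A : Set AP, α.HoldsAt A

end Literal

/-- Non-strict bounds. -/
inductive Bound
  | le | ge

/-- A non-strict bound as a comparison operator. -/
def Bound.toCmp : Bound → Cmp
  | le => .le
  | ge => .ge

/-- The flat formulas without Boolean connectives: `P_{⋈ q}(X α)`, `P_{⋈ q}(α U β)`,
`P_{⋈ q}(α W β)` with `⋈ ∈ {≤, ≥}`. -/
inductive FlatAtom (AP : Type*)
  | probX (b : Bound) (q : unitInterval) (α : Literal AP) : FlatAtom AP
  | probU (b : Bound) (q : unitInterval) (α β : Literal AP) : FlatAtom AP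
  | probW (b : Bound) (q : unitInterval) (α β : Literal AP) : FlatAtom AP

/-- Flat PCTL formulas. -/
inductive Flat (AP : Type*)
  | prob (φ : FlatAtom AP) : Flat AP
  | and (Φ Ψ : Flat AP) : Flat AP
  | or (Φ Ψ : Flat AP) : Flat AP

/-- Flat PCTL formulas without conjunctions, except in literal formulas. -/
inductive Clause (AP : Type*)
  | prob (φ : FlatAtom AP) : Clause AP
  | or (Γ Δ : Clause AP) : Clause AP

/-- Conjunctions `Φ₁ ∧ … ∧ Φₙ`, `n ≥ 1`, of clauses. -/
inductive ClauseConj (AP : Type*)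
  | single (Γ : Clause AP) : ClauseConj AP
  | and (Θ Ξ : ClauseConj AP) : ClauseConj AP

section FlatSyntax

variable {AP : Type*}

/-- A flat formula without Boolean connectives as a PCTL formula. -/
def FlatAtom.toPCTL : FlatAtom AP → PCTL AP
  | probX b q α => .probX b.toCmp q α.toPCTL
  | probU b q α β => .probU b.toCmp q α.toPCTL β.toPCTL
  | probW b q α β => .probW b.toCmp q α.toPCTL β.toPCTL

/-- A flat formula as a PCTL formula. -/
def Flat.toPCTL : Flat AP → PCTL AP
  | prob φ => φ.toPCTL
  | and Φ Ψ => .and Φ.toPCTL Ψ.toPCTL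
  | or Φ Ψ => .or Φ.toPCTL Ψ.toPCTL

/-- A clause as a flat formula. -/
def Clause.toFlat : Clause AP → Flat AP
  | prob φ => .prob φ
  | or Γ Δ => .or Γ.toFlat Δ.toFlat

/-- A conjunction of clauses as a flat formula. -/
def ClauseConj.toFlat : ClauseConj AP → Flat AP
  | single Γ => Γ.toFlat
  | and Θ Ξ => .and Θ.toFlat Ξ.toFlat

/-! ### The decomposition algorithm -/

/-- The closure formula of a flat formula without Boolean connectives. -/
def FlatAtom.cls : FlatAtom AP → FlatAtom AP
  | probX b q α => probX b q α
  | probU .le q α β => probU .le q α β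
  | probU .ge q α β => probW .ge q α β
  | probW .ge q α β => probW .ge q α β
  | probW .le q α β => probU .le q α β

/-- The closure formula of a clause. -/
def Clause.cls : Clause AP → Clause AP
  | prob φ => prob φ.cls
  | or Γ Δ => or Γ.cls Δ.cls

/-- `(Φ₁ ∧ … ∧ Φₙ) ∨ Δ`, distributed. -/
def ClauseConj.orClause : ClauseConj AP → Clause AP → ClauseConj AP
  | single Γ, Δ => single (.or Γ Δ)
  | and Θ Ξ, Δ => and (Θ.orClause Δ) (Ξ.orClause Δ)

/-- `(Φ₁ ∧ … ∧ Φₙ) ∨ (Ψ₁ ∧ … ∧ Ψₘ)`, distributed. -/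
def ClauseConj.distribute (Θ : ClauseConj AP) : ClauseConj AP → ClauseConj AP
  | single Δ => Θ.orClause Δ
  | and Ξ Ξ' => and (Θ.distribute Ξ) (Θ.distribute Ξ')

/-- First step: a flat formula is transformed into a conjunction of clauses by distributivity. -/
def Flat.toClauses : Flat AP → ClauseConj AP
  | prob φ => .single (.prob φ)
  | and Φ Ψ => .and Φ.toClauses Ψ.toClauses
  | or Φ Ψ => Φ.toClauses.distribute Ψ.toClauses

/-- The conjunction of the closure formulas `cls(Φᵢ)` of the clauses `Φᵢ`. -/
def ClauseConj.safePart : ClauseConj AP → Flat AP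
  | single Γ => Γ.cls.toFlat
  | and Θ Ξ => .and Θ.safePart Ξ.safePart

/-- The conjunction of the formulas `Φᵢ ∨ ¬ cls(Φᵢ)`, for the clauses `Φᵢ`. -/
def ClauseConj.livePart : ClauseConj AP → PCTL AP
  | single Γ => .or Γ.toFlat.toPCTL (.neg Γ.cls.toFlat.toPCTL)
  | and Θ Ξ => .and Θ.livePart Ξ.livePart

/-- The decomposition algorithm: it returns `(Φˢ, Φˡ)`. -/
def decompose (Φ : Flat AP) : Flat AP × PCTL AP :=
  (Φ.toClauses.safePart, Φ.toClauses.livePart)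

/-- Excludes `P_{≥ q}(α U β)` with `q > 0` and `P_{≤ q}(α W β)` with `q < 1` for `α` valid and
`β` unsatisfiable. -/
def FlatAtom.Nondegenerate : FlatAtom AP → Prop
  | probU .ge q α β => q = 0 ∨ ¬ α.Valid ∨ β.Satisfiable
  | probW .le q α β => q = 1 ∨ ¬ α.Valid ∨ β.Satisfiable
  | _ => True

/-- All subformulas `P_{⋈ q}(φ)` are nondegenerate. -/
def Flat.Nondegenerate : Flat AP → Prop
  | prob φ => φ.Nondegenerate
  | and Φ Ψ => Φ.Nondegenerate ∧ Ψ.Nondegenerate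
  | or Φ Ψ => Φ.Nondegenerate ∧ Ψ.Nondegenerate

end FlatSyntax

end

end ProbLogic

open ProbLogic

/-! Let F be the expansion operator of `A U B` on valuations: 1 where B holds, otherwise 0 where A
fails, otherwise the average over the successors. The path measure obeys the Markov property at time
one, so the probability of `A U B` is the supremum of the iterates F^n 0 and that of `A W B` is the
infimum of the iterates F^n 1. These values are invariant under maps that preserve labels and
successor distributions. A total tree is isomorphic to the unfolding of the chain on its own nodes,
so it has a flat property iff the values at its own root satisfy the bounds
(`Flat.mem_property_iff`).

In a total tree, F^(n+1) of a constant at the root depends only on the nodes of length at most n + 1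
(`iterate_step_root_eq`). Hence a violation of "U at most q" or of "W at least q" shows in a finite
prefix, and these properties are closed. Conversely, if W is at least q and some label satisfies β,
continuing a cut of the tree with that label turns the undecided paths into successes, so U is at
least q in the extension; dually, a label violating α and β turns them into failures of W. In the
cases outside the side conditions the property is empty. Closure commutes with finite unions because
the cuts of a tree form a chain.

For the decomposition, Φᵢ implies Φᵢˢ, so Φᵢ is equivalent to Φᵢˢ together with Φᵢˢ → Φᵢ. Liveness
needs one tree for all clauses at once: below the given finite-depth tree every label is made to
occur on all nodes of some length, which forces U and W to have equal values unless α is valid and β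
unsatisfiable (`exists_isPrefix_property_cls_subset`). The degenerate atoms are unsatisfiable and
can be replaced beforehand by a harmless unsatisfiable atom. -/

namespace ProbLogic

noncomputable section

open MeasureTheory ProbabilityTheory

/-! ### Path measures of Markov chains -/

/-- The infinite sequences that agree with `x` up to time `n`. -/
def pathCylinder {S : Type*} (n : ℕ) (x : ℕ → S) : Set (ℕ → S) :=
  {π | ∀ i ≤ n, π i = x i}

theorem frestrictLe_preimage_singleton {S : Type*} (n : ℕ) (x : ℕ → S) :
    Preorder.frestrictLe (π := fun _ => S) n ⁻¹' {Preorder.frestrictLe n x} =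
      pathCylinder n x := by
  ext π
  simp only [Set.mem_preimage, Set.mem_singleton_iff, pathCylinder, Set.mem_ofPred_eq]
  constructor
  · intro h i hi
    exact congrFun h ⟨i, Finset.mem_Iic.2 hi⟩
  · intro h
    funext i
    exact h i (Finset.mem_Iic.1 i.2)

theorem exists_frestrictLe_eq {S : Type*} (n : ℕ) (y : (_i : Finset.Iic n) → S) :
    ∃ x : ℕ → S, Preorder.frestrictLe (π := fun _ => S) n x = y := by
  refine ⟨fun i => y ⟨min i n, by simp⟩, ?_⟩
  funext i
  have h : min (i : ℕ) n = i := min_eq_left (Finset.mem_Iic.1 i.2)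
  simp [h]

theorem measurable_frestrictLe_const {S : Type*} [MeasurableSpace S] (n : ℕ) :
    Measurable (Preorder.frestrictLe (π := fun _ : ℕ => S) n) :=
  Preorder.measurable_frestrictLe n

/-- The path that starts in `s` and continues as `π`. -/
def consPath {S : Type*} (s : S) (π : ℕ → S) : ℕ → S
  | 0 => s
  | n + 1 => π n

theorem measurable_consPath {S : Type*} [MeasurableSpace S] (s : S) :
    Measurable (consPath s) := by
  refine measurable_pi_lambda _ fun n => ?_
  cases n with
  | zero => exact measurable_const
  | succ n => exact measurable_pi_apply n

section

variable {S : Type*} [MeasurableSpace S] [DiscreteMeasurableSpace S] [Countable S]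

/-- Finite measures on the infinite sequences are determined by the cylinders. -/
theorem measure_ext_of_pathCylinder (μ ν : Measure (ℕ → S)) [IsFiniteMeasure μ]
    [IsFiniteMeasure ν] (h : ∀ n x, μ (pathCylinder n x) = ν (pathCylinder n x)) : μ = ν := by
  let P : (I : Finset ℕ) → Measure ((i : I) → S) := fun I => μ.map I.restrict
  have hP : IsProjectiveMeasureFamily (α := fun _ : ℕ => S) P := by
    intro I J hJI
    change μ.map _ = (μ.map _).map _
    rw [Measure.map_map (by fun_prop) (by fun_prop)]
    rfl
  have hμ : IsProjectiveLimit (α := fun _ : ℕ => S) μ P := fun I => rfl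
  refine hμ.unique ((isProjectiveLimit_nat_iff (X := fun _ => S) hP ν).2 fun n => ?_)
  change _ = μ.map (Preorder.frestrictLe n)
  -- There are countably many initial segments, so the marginal is determined by its point masses,
  -- which are the masses of cylinders.
  rw [Measure.ext_iff_singleton]
  intro y
  obtain ⟨x, rfl⟩ := exists_frestrictLe_eq n y
  rw [Measure.map_apply (measurable_frestrictLe_const n) (measurableSet_singleton _),
    Measure.map_apply (measurable_frestrictLe_const n) (measurableSet_singleton _),
    frestrictLe_preimage_singleton, h]

end

namespace MarkovChain

variable {S AP : Type*} [MeasurableSpace S] [DiscreteMeasurableSpace S]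

instance (D : MarkovChain S AP) (s : S) : IsProbabilityMeasure (D.pathMeasure s) := by
  unfold pathMeasure
  infer_instance

variable [Countable S]

/-- The one-step kernel keeps the history and draws the new coordinate from `stepKernel n`; a point
is hit only from its own history. -/
theorem partialTraj_succ_singleton (D : MarkovChain S AP) (n : ℕ) (z x : ℕ → S) :
    Kernel.partialTraj (X := fun _ => S) D.stepKernel n (n + 1) (Preorder.frestrictLe n z)
        {Preorder.frestrictLe (n + 1) x} =
      Set.indicator {Preorder.frestrictLe (π := fun _ => S) n x}
        (fun _ => D.trans (x n) (x (n + 1))) (Preorder.frestrictLe n z) := by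
  rw [Kernel.partialTraj_succ_self, Kernel.map_apply' _
    (measurable_IicProdIoc (X := fun _ => S) (m := n) (n := n + 1)) _
    (measurableSet_singleton _), Kernel.id_prod_apply' _ _
    (measurable_IicProdIoc (X := fun _ => S) (m := n) (n := n + 1) (measurableSet_singleton _)),
    Kernel.map_apply' _
    (by fun_prop) _ (MeasurableSet.of_discrete)]
  by_cases h : Preorder.frestrictLe (π := fun _ => S) n z = Preorder.frestrictLe n x
  · rw [Set.indicator_of_mem (by simpa using h), h]
    have : (MeasurableEquiv.piSingleton (X := fun _ => S) n) ⁻¹'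
        (Prod.mk (Preorder.frestrictLe (π := fun _ => S) n x) ⁻¹'
          (IicProdIoc (X := fun _ => S) n (n + 1) ⁻¹'
            {Preorder.frestrictLe (n + 1) x})) = {x (n + 1)} := by
      ext t
      simp only [Set.mem_preimage, Set.mem_singleton_iff, funext_iff, IicProdIoc,
        MeasurableEquiv.piSingleton]
      constructor
      · intro h
        simpa using h ⟨n + 1, by simp⟩
      · rintro rfl ⟨i, hi⟩
        by_cases hin : i ≤ n
        · simp [hin]
        · obtain rfl : i = n + 1 := by
            have := Finset.mem_Iic.1 hi
            omega
          simp
    rw [this]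
    change (D.trans (x n)).toMeasure _ = _
    rw [PMF.toMeasure_apply_singleton _ _ (measurableSet_singleton _)]
  · rw [Set.indicator_of_notMem (by simpa using h)]
    have : (MeasurableEquiv.piSingleton (X := fun _ => S) n) ⁻¹'
        (Prod.mk (Preorder.frestrictLe (π := fun _ => S) n z) ⁻¹'
          (IicProdIoc (X := fun _ => S) n (n + 1) ⁻¹'
            {Preorder.frestrictLe (n + 1) x})) = ∅ := by
      ext t
      simp only [Set.mem_preimage, Set.mem_singleton_iff, Set.mem_empty_iff_false, iff_false]
      intro h'
      refine h (funext fun i => ?_)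
      have hi := Finset.mem_Iic.1 i.2
      have := congrFun h' ⟨i, Finset.mem_Iic.2 (by omega)⟩
      simpa [IicProdIoc, hi] using this
    rw [this, measure_empty]

/-- The marginal up to n + 1 is the marginal up to n followed by the one-step kernel, and the
integrand is supported on a single history. -/
theorem pathMeasure_pathCylinder_succ (D : MarkovChain S AP) (s : S) (n : ℕ) (x : ℕ → S) :
    D.pathMeasure s (pathCylinder (n + 1) x) =
      D.pathMeasure s (pathCylinder n x) * D.trans (x n) (x (n + 1)) := by
  have key : ∀ m, D.pathMeasure s (pathCylinder m x) =
      Kernel.partialTraj (X := fun _ => S) D.stepKernel 0 m (fun _ => s)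
        {Preorder.frestrictLe m x} := by
    intro m
    rw [← Kernel.traj_map_frestrictLe_apply,
      Measure.map_apply (measurable_frestrictLe_const m) (measurableSet_singleton _),
      frestrictLe_preimage_singleton]
    rfl
  rw [key, key, Kernel.partialTraj_succ_eq_comp (Nat.zero_le n),
    Kernel.comp_apply' _ _ _ (measurableSet_singleton _)]
  have : ∀ y : (_i : Finset.Iic n) → S,
      Kernel.partialTraj (X := fun _ => S) D.stepKernel n (n + 1) y
        {Preorder.frestrictLe (n + 1) x} =
      Set.indicator {Preorder.frestrictLe (π := fun _ => S) n x}
        (fun _ => D.trans (x n) (x (n + 1))) y := by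
    intro y
    obtain ⟨z, rfl⟩ := exists_frestrictLe_eq n y
    exact D.partialTraj_succ_singleton n z x
  rw [lintegral_congr this, lintegral_indicator (measurableSet_singleton _), lintegral_const,
    Measure.restrict_apply_univ, mul_comm]

open Classical in
theorem pathMeasure_pathCylinder_zero (D : MarkovChain S AP) (s : S) (x : ℕ → S) :
    D.pathMeasure s (pathCylinder 0 x) = if s = x 0 then 1 else 0 := by
  have : D.pathMeasure s (pathCylinder 0 x) =
      Kernel.partialTraj (X := fun _ => S) D.stepKernel 0 0 (fun _ => s)
        {Preorder.frestrictLe 0 x} := by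
    rw [← Kernel.traj_map_frestrictLe_apply,
      Measure.map_apply (measurable_frestrictLe_const 0) (measurableSet_singleton _),
      frestrictLe_preimage_singleton]
    rfl
  rw [this, Kernel.partialTraj_self, Kernel.id_apply, Measure.dirac_apply, Set.indicator_apply]
  refine if_congr ?_ rfl rfl
  simp only [Set.mem_singleton_iff, funext_iff]
  constructor
  · intro h
    exact h ⟨0, by simp⟩
  · rintro h ⟨i, hi⟩
    obtain rfl : i = 0 := by simpa using hi
    exact h

open Classical in
theorem pathMeasure_pathCylinder (D : MarkovChain S AP) (s : S) (n : ℕ) (x : ℕ → S) :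
    D.pathMeasure s (pathCylinder n x) =
      if s = x 0 then ∏ i ∈ Finset.range n, D.trans (x i) (x (i + 1)) else 0 := by
  induction n with
  | zero => rw [pathMeasure_pathCylinder_zero]; simp
  | succ n ih =>
    rw [pathMeasure_pathCylinder_succ, ih, Finset.prod_range_succ]
    split_ifs <;> simp

/-- The Markov property at time one. -/
theorem pathMeasure_eq_sum (D : MarkovChain S AP) (s : S) :
    D.pathMeasure s = Measure.sum fun t =>
      D.trans s t • (D.pathMeasure t).map (consPath s) := by
  classical
  have hm := measurable_consPath s
  have hfin : IsFiniteMeasure (Measure.sum fun t =>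
      D.trans s t • (D.pathMeasure t).map (consPath s)) := by
    refine ⟨?_⟩
    rw [Measure.sum_apply _ MeasurableSet.univ]
    simp [Measure.map_apply hm MeasurableSet.univ, (D.trans s).tsum_coe]
  refine measure_ext_of_pathCylinder _ _ fun n x => ?_
  have hcyl : MeasurableSet (pathCylinder n x) := by
    rw [← frestrictLe_preimage_singleton]
    exact measurable_frestrictLe_const n (measurableSet_singleton _)
  rw [Measure.sum_apply _ hcyl]
  simp only [Measure.smul_apply, Measure.map_apply hm hcyl, smul_eq_mul]
  cases n with
  | zero =>
    rw [pathMeasure_pathCylinder]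
    by_cases h : s = x 0
    · have : consPath s ⁻¹' pathCylinder 0 x =
          Set.univ := by
        ext π
        simpa [pathCylinder, consPath] using h
      rw [this, if_pos h]
      simp [(D.trans s).tsum_coe]
    · have : consPath s ⁻¹' pathCylinder 0 x = ∅ := by
        ext π
        simpa [pathCylinder, consPath] using h
      simp [this, h]
  | succ n =>
    by_cases h : s = x 0
    · have : consPath s ⁻¹' pathCylinder (n + 1) x =
          pathCylinder n (fun i => x (i + 1)) := by
        ext π
        simp only [pathCylinder, Set.mem_preimage, Set.mem_ofPred_eq]
        constructor
        · intro h' i hi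
          exact h' (i + 1) (by omega)
        · rintro h' (_ | i) hi
          · exact h
          · exact h' i (by omega)
      -- Only the start t = x 1 can lie in the shifted cylinder; its weight supplies the first
      -- factor of the product.
      rw [this, pathMeasure_pathCylinder, if_pos h, tsum_eq_single (x 1), pathMeasure_pathCylinder,
        if_pos rfl, Finset.prod_range_succ', mul_comm, h]
      intro t ht
      rw [pathMeasure_pathCylinder, if_neg ht, mul_zero]
    · have : consPath s ⁻¹' pathCylinder (n + 1) x =
          ∅ := by
        ext π
        simp only [pathCylinder, Set.mem_preimage, Set.mem_ofPred_eq, Set.mem_empty_iff_false,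
          iff_false]
        intro h'
        exact h (h' 0 (by omega))
      rw [this, pathMeasure_pathCylinder, if_neg h]
      simp

end MarkovChain

/-! ### Expansion laws -/

open Classical in
/-- The expansion operator of `A U B` and `A W B` on valuations, for the edge weights `p`. -/
def stepVal {V : Type*} (p : V → V → ℝ≥0∞) (A B : V → Prop) (f : V → ℝ≥0∞) (v : V) : ℝ≥0∞ :=
  if B v then 1 else if A v then ∑' w, p v w * f w else 0

theorem stepVal_mono {V : Type*} (p : V → V → ℝ≥0∞) (A B : V → Prop) :
    Monotone (stepVal p A B) := by
  intro f g h v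
  unfold stepVal
  split_ifs
  · exact le_rfl
  · exact ENNReal.tsum_le_tsum fun w => mul_le_mul_right (h w) _
  · exact le_rfl

theorem stepVal_one_le {V : Type*} {p : V → V → ℝ≥0∞} (hp : ∀ v, ∑' w, p v w ≤ 1)
    (A B : V → Prop) : stepVal p A B 1 ≤ 1 := by
  intro v
  unfold stepVal
  split_ifs
  · exact le_rfl
  · simpa using hp v
  · exact zero_le_one

/-- The value of `X B`. -/
def nextVal {V : Type*} (p : V → V → ℝ≥0∞) (B : V → Prop) : V → ℝ≥0∞ :=
  stepVal p (fun _ => True) (fun _ => False) (stepVal p (fun _ => False) B 0)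

/-- The value of `A U B`. -/
def untilVal {V : Type*} (p : V → V → ℝ≥0∞) (A B : V → Prop) (v : V) : ℝ≥0∞ :=
  ⨆ n, (stepVal p A B)^[n] 0 v

/-- The value of `A W B`. -/
def weakUntilVal {V : Type*} (p : V → V → ℝ≥0∞) (A B : V → Prop) (v : V) : ℝ≥0∞ :=
  ⨅ n, (stepVal p A B)^[n] 1 v

/-- The iterates from 0 increase and those from 1 decrease, the latter because the weights sum to at
most one; they are compared at a common index. -/
theorem untilVal_le_iterate_one {V : Type*} {p : V → V → ℝ≥0∞} (hp : ∀ v, ∑' w, p v w ≤ 1)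
    (A B : V → Prop) (v : V) (n : ℕ) : untilVal p A B v ≤ (stepVal p A B)^[n] 1 v := by
  have hm := stepVal_mono p A B
  refine iSup_le fun m => ?_
  have h0 : Monotone fun n => (stepVal p A B)^[n] 0 :=
    hm.monotone_iterate_of_le_map (fun _ => zero_le)
  have h1 : Antitone fun n => (stepVal p A B)^[n] 1 :=
    hm.antitone_iterate_of_map_le (stepVal_one_le hp A B)
  exact (h0 (le_max_left m n) v).trans
    ((hm.iterate (max m n) (fun _ => zero_le_one) v).trans (h1 (le_max_right m n) v))

theorem untilVal_le_weakUntilVal {V : Type*} {p : V → V → ℝ≥0∞} (hp : ∀ v, ∑' w, p v w ≤ 1)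
    (A B : V → Prop) (v : V) : untilVal p A B v ≤ weakUntilVal p A B v :=
  le_iInf fun n => untilVal_le_iterate_one hp A B v n

theorem weakUntilVal_le_one {V : Type*} (p : V → V → ℝ≥0∞) (A B : V → Prop) (v : V) :
    weakUntilVal p A B v ≤ 1 :=
  iInf_le (fun n => (stepVal p A B)^[n] 1 v) 0

/-- The paths `π` with `B (π 0)`, or with `A (π 0)` and the tail of `π` in `E`. -/
def stepPaths {S : Type*} (A B : S → Prop) (E : Set (ℕ → S)) : Set (ℕ → S) :=
  {π | B (π 0) ∨ A (π 0) ∧ (fun n => π (n + 1)) ∈ E}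

theorem stepPaths_mono {S : Type*} (A B : S → Prop) : Monotone (stepPaths A B) := by
  rintro E F h π (hB | ⟨hA, hE⟩)
  · exact Or.inl hB
  · exact Or.inr ⟨hA, h hE⟩

theorem mem_iterate_stepPaths_empty {S : Type*} (A B : S → Prop) (n : ℕ) (π : ℕ → S) :
    π ∈ (stepPaths A B)^[n] ∅ ↔ ∃ j < n, B (π j) ∧ ∀ k < j, A (π k) := by
  induction n generalizing π with
  | zero => simp
  | succ n ih =>
    rw [Function.iterate_succ_apply']
    change (B (π 0) ∨ A (π 0) ∧ (fun n => π (n + 1)) ∈ (stepPaths A B)^[n] ∅) ↔ _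
    rw [ih]
    constructor
    · rintro (h | ⟨hA, j, hj, hB, hk⟩)
      · exact ⟨0, by omega, h, by simp⟩
      · refine ⟨j + 1, by omega, hB, ?_⟩
        rintro (_ | k) hkj
        · exact hA
        · exact hk k (by omega)
    · rintro ⟨_ | j, hj, hB, hk⟩
      · exact Or.inl hB
      · exact Or.inr ⟨hk 0 (by omega), j, by omega, hB, fun k hkj => hk (k + 1) (by omega)⟩

/-- The iterates from ∅ contain the paths that succeed within n positions; starting from everything
also keeps the paths still undecided. -/
theorem mem_iterate_stepPaths_univ {S : Type*} (A B : S → Prop) (n : ℕ) (π : ℕ → S) :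
    π ∈ (stepPaths A B)^[n] Set.univ ↔
      (∃ j < n, B (π j) ∧ ∀ k < j, A (π k)) ∨ ∀ k < n, A (π k) := by
  induction n generalizing π with
  | zero => simp
  | succ n ih =>
    rw [Function.iterate_succ_apply']
    change (B (π 0) ∨ A (π 0) ∧ (fun n => π (n + 1)) ∈ (stepPaths A B)^[n] Set.univ) ↔ _
    rw [ih]
    constructor
    · rintro (h | ⟨hA, ⟨j, hj, hB, hk⟩ | hk⟩)
      · exact Or.inl ⟨0, by omega, h, by simp⟩
      · refine Or.inl ⟨j + 1, by omega, hB, ?_⟩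
        rintro (_ | k) hkj
        · exact hA
        · exact hk k (by omega)
      · refine Or.inr ?_
        rintro (_ | k) hkj
        · exact hA
        · exact hk k (by omega)
    · rintro (⟨_ | j, hj, hB, hk⟩ | hk)
      · exact Or.inl hB
      · exact Or.inr ⟨hk 0 (by omega),
          Or.inl ⟨j, by omega, hB, fun k hkj => hk (k + 1) (by omega)⟩⟩
      · exact Or.inr ⟨hk 0 (by omega), Or.inr fun k hkj => hk (k + 1) (by omega)⟩

theorem untilPaths_eq_iUnion {S : Type*} (A B : S → Prop) :
    untilPaths A B = ⋃ n, (stepPaths A B)^[n] ∅ := by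
  ext π
  simp only [Set.mem_iUnion, mem_iterate_stepPaths_empty]
  constructor
  · rintro ⟨j, h⟩
    exact ⟨j + 1, j, by omega, h⟩
  · rintro ⟨_, j, _, h⟩
    exact ⟨j, h⟩

theorem weakUntilPaths_eq_iInter {S : Type*} (A B : S → Prop) :
    weakUntilPaths A B = ⋂ n, (stepPaths A B)^[n] Set.univ := by
  ext π
  simp only [Set.mem_iInter, mem_iterate_stepPaths_univ]
  constructor
  · rintro (⟨j, hB, hk⟩ | h) n
    · by_cases hj : j < n
      · exact Or.inl ⟨j, hj, hB, hk⟩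
      · exact Or.inr fun k hkn => hk k (by omega)
    · exact Or.inr fun k _ => h k
  · intro h
    by_cases hU : π ∈ untilPaths A B
    · exact Or.inl hU
    · refine Or.inr fun i => ?_
      rcases h (i + 1) with ⟨j, _, hj⟩ | h'
      · exact absurd ⟨j, hj⟩ hU
      · exact h' i (by omega)

/-- With `X` written as two expansion steps, an unconditional move and then a test, all facts about
expansion steps apply to it. -/
theorem nextPaths_eq {S : Type*} (A : S → Prop) :
    nextPaths A =
      stepPaths (fun _ => True) (fun _ => False) (stepPaths (fun _ => False) A ∅) := by
  ext π
  simp [nextPaths, stepPaths]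

theorem measurableSet_stepPaths {S : Type*} [MeasurableSpace S] [DiscreteMeasurableSpace S]
    (A B : S → Prop) {E : Set (ℕ → S)} (hE : MeasurableSet E) :
    MeasurableSet (stepPaths A B E) := by
  have h0 : ∀ C : S → Prop, MeasurableSet {π : ℕ → S | C (π 0)} := fun C =>
    measurable_pi_apply (X := fun _ : ℕ => S) 0 (MeasurableSet.of_discrete (s := {s | C s}))
  have h1 : Measurable fun (π : ℕ → S) (n : ℕ) => π (n + 1) :=
    measurable_pi_lambda _ fun n => measurable_pi_apply (n + 1)
  exact (h0 B).union ((h0 A).inter (h1 hE))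

theorem measurableSet_iterate_stepPaths {S : Type*} [MeasurableSpace S]
    [DiscreteMeasurableSpace S] (A B : S → Prop) {E : Set (ℕ → S)} (hE : MeasurableSet E)
    (n : ℕ) : MeasurableSet ((stepPaths A B)^[n] E) := by
  induction n with
  | zero => exact hE
  | succ n ih =>
    rw [Function.iterate_succ_apply']
    exact measurableSet_stepPaths A B ih

namespace MarkovChain

section

variable {S AP : Type*} [MeasurableSpace S] [DiscreteMeasurableSpace S] [Countable S]

/-- By the Markov property only the preimage under `consPath s` matters, and the tests at s make it
everything, E or empty. -/
theorem pathMeasure_stepPaths (D : MarkovChain S AP) (A B : S → Prop) {E : Set (ℕ → S)}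
    (hE : MeasurableSet E) (s : S) :
    D.pathMeasure s (stepPaths A B E) =
      stepVal (fun s => D.trans s) A B (fun t => D.pathMeasure t E) s := by
  have hm := measurable_consPath s
  have hS := measurableSet_stepPaths A B hE
  rw [pathMeasure_eq_sum, Measure.sum_apply _ hS]
  simp only [Measure.smul_apply, Measure.map_apply hm hS, smul_eq_mul]
  unfold stepVal
  split_ifs with hB hA
  · have : consPath s ⁻¹' stepPaths A B E = Set.univ :=
      Set.eq_univ_of_forall fun π => Or.inl hB
    simp [this, (D.trans s).tsum_coe]
  · have : consPath s ⁻¹' stepPaths A B E = E := by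
      ext π
      exact ⟨fun h => h.elim (fun h => absurd h hB) And.right, fun h => Or.inr ⟨hA, h⟩⟩
    rw [this]
  · have : consPath s ⁻¹' stepPaths A B E = ∅ :=
      Set.eq_empty_of_forall_notMem fun π h => h.elim hB fun h => hA h.1
    simp [this]

theorem pathMeasure_iterate_stepPaths (D : MarkovChain S AP) (A B : S → Prop)
    {E : Set (ℕ → S)} (hE : MeasurableSet E) (n : ℕ) (s : S) :
    D.pathMeasure s ((stepPaths A B)^[n] E) =
      (stepVal (fun s => D.trans s) A B)^[n] (fun t => D.pathMeasure t E) s := by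
  induction n generalizing s with
  | zero => rfl
  | succ n ih =>
    rw [Function.iterate_succ_apply', Function.iterate_succ_apply',
      pathMeasure_stepPaths D A B (measurableSet_iterate_stepPaths A B hE n)]
    simp only [ih]

/-- Continuity of the measure from below along the bounded approximations. -/
theorem pathMeasure_untilPaths (D : MarkovChain S AP) (A B : S → Prop) (s : S) :
    D.pathMeasure s (untilPaths A B) = untilVal (fun s => D.trans s) A B s := by
  have hmono : Monotone fun n => (stepPaths A B)^[n] ∅ :=
    (stepPaths_mono A B).monotone_iterate_of_le_map (Set.empty_subset _)
  rw [untilPaths_eq_iUnion, hmono.measure_iUnion]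
  unfold untilVal
  refine iSup_congr fun n => ?_
  rw [pathMeasure_iterate_stepPaths D A B MeasurableSet.empty]
  simp only [measure_empty]
  rfl

/-- Continuity from above, available since the measure is finite. -/
theorem pathMeasure_weakUntilPaths (D : MarkovChain S AP) (A B : S → Prop) (s : S) :
    D.pathMeasure s (weakUntilPaths A B) = weakUntilVal (fun s => D.trans s) A B s := by
  have hanti : Antitone fun n => (stepPaths A B)^[n] Set.univ :=
    (stepPaths_mono A B).antitone_iterate_of_map_le (Set.subset_univ _)
  rw [weakUntilPaths_eq_iInter, hanti.measure_iInter
    (fun n => (measurableSet_iterate_stepPaths A B MeasurableSet.univ n).nullMeasurableSet)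
    ⟨0, measure_ne_top _ _⟩]
  unfold weakUntilVal
  refine iInf_congr fun n => ?_
  rw [pathMeasure_iterate_stepPaths D A B MeasurableSet.univ]
  simp only [measure_univ]
  rfl

theorem pathMeasure_nextPaths (D : MarkovChain S AP) (A : S → Prop) (s : S) :
    D.pathMeasure s (nextPaths A) = nextVal (fun s => D.trans s) A s := by
  rw [nextPaths_eq, pathMeasure_stepPaths D _ _ (measurableSet_stepPaths _ _ MeasurableSet.empty)]
  simp only [pathMeasure_stepPaths D _ _ MeasurableSet.empty, measure_empty]
  rfl

end

variable {S AP : Type*}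

theorem pr_untilPaths [Countable S] (D : MarkovChain S AP) (A B : S → Prop) (s : S) :
    D.pr s (untilPaths A B) = (untilVal (fun s => D.trans s) A B s).toReal := by
  let _ : MeasurableSpace S := ⊤
  exact congrArg ENNReal.toReal (D.pathMeasure_untilPaths A B s)

theorem pr_weakUntilPaths [Countable S] (D : MarkovChain S AP) (A B : S → Prop) (s : S) :
    D.pr s (weakUntilPaths A B) = (weakUntilVal (fun s => D.trans s) A B s).toReal := by
  let _ : MeasurableSpace S := ⊤
  exact congrArg ENNReal.toReal (D.pathMeasure_weakUntilPaths A B s)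

theorem pr_nextPaths [Countable S] (D : MarkovChain S AP) (A : S → Prop) (s : S) :
    D.pr s (nextPaths A) = (nextVal (fun s => D.trans s) A s).toReal := by
  let _ : MeasurableSpace S := ⊤
  exact congrArg ENNReal.toReal (D.pathMeasure_nextPaths A s)

theorem pr_mono (D : MarkovChain S AP) (s : S) {E F : Set (ℕ → S)} (h : E ⊆ F) :
    D.pr s E ≤ D.pr s F := by
  let _ : MeasurableSpace S := ⊤
  exact measureReal_mono (μ := D.pathMeasure s) h

theorem pr_empty (D : MarkovChain S AP) (s : S) : D.pr s ∅ = 0 := by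
  let _ : MeasurableSpace S := ⊤
  exact measureReal_empty (μ := D.pathMeasure s)

theorem pr_univ (D : MarkovChain S AP) (s : S) : D.pr s Set.univ = 1 := by
  let _ : MeasurableSpace S := ⊤
  exact probReal_univ (μ := D.pathMeasure s)

end MarkovChain

/-! ### Transfer of values between weighted graphs -/

theorem stepVal_congr {V W : Type*} {p : V → V → ℝ≥0∞} {p' : W → W → ℝ≥0∞}
    {A B : V → Prop} {A' B' : W → Prop} {f : V → ℝ≥0∞} {f' : W → ℝ≥0∞} {v : V} {w : W}
    (hA : A v ↔ A' w) (hB : B v ↔ B' w)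
    (h : ∑' x, p v x * f x = ∑' x, p' w x * f' x) :
    stepVal p A B f v = stepVal p' A' B' f' w := by
  classical
  exact if_congr hB rfl (if_congr hA h rfl)

/-- On the set `N`, the map `g` preserves labels and the distributions of the successors. -/
structure IsBisimulation {V W AP : Type*} (p : V → V → ℝ≥0∞) (l : V → Set AP)
    (p' : W → W → ℝ≥0∞) (l' : W → Set AP) (N : Set V) (g : V → W) : Prop where
  mem : ∀ v ∈ N, ∀ w, p v w ≠ 0 → w ∈ N
  label : ∀ v ∈ N, l' (g v) = l v
  tsum : ∀ v ∈ N, ∀ f : W → ℝ≥0∞, ∑' w, p v w * f (g w) = ∑' w, p' (g v) w * f w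

namespace IsBisimulation

variable {V W AP : Type*} {p : V → V → ℝ≥0∞} {l : V → Set AP} {p' : W → W → ℝ≥0∞}
  {l' : W → Set AP} {N : Set V} {g : V → W}

theorem stepVal_eq (h : IsBisimulation p l p' l' N g) (A B : Set AP → Prop)
    {f : V → ℝ≥0∞} {f' : W → ℝ≥0∞} (hf : ∀ v ∈ N, f v = f' (g v)) (v : V) (hv : v ∈ N) :
    stepVal p (fun v => A (l v)) (fun v => B (l v)) f v =
      stepVal p' (fun v => A (l' v)) (fun v => B (l' v)) f' (g v) := by
  refine stepVal_congr (by rw [h.label v hv]) (by rw [h.label v hv]) ?_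
  rw [← h.tsum v hv]
  refine tsum_congr fun w => ?_
  -- Edges of weight zero may leave N, where the two valuations need not correspond.
  by_cases hw : p v w = 0
  · simp [hw]
  · rw [hf w (h.mem v hv w hw)]

theorem iterate_stepVal_eq (h : IsBisimulation p l p' l' N g) (A B : Set AP → Prop)
    {f : V → ℝ≥0∞} {f' : W → ℝ≥0∞} (hf : ∀ v ∈ N, f v = f' (g v)) (n : ℕ) (v : V)
    (hv : v ∈ N) :
    (stepVal p (fun v => A (l v)) (fun v => B (l v)))^[n] f v =
      (stepVal p' (fun v => A (l' v)) (fun v => B (l' v)))^[n] f' (g v) := by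
  induction n generalizing v with
  | zero => exact hf v hv
  | succ n ih =>
    rw [Function.iterate_succ_apply', Function.iterate_succ_apply']
    exact h.stepVal_eq A B ih v hv

theorem untilVal_eq (h : IsBisimulation p l p' l' N g) (A B : Set AP → Prop) (v : V)
    (hv : v ∈ N) :
    untilVal p (fun v => A (l v)) (fun v => B (l v)) v =
      untilVal p' (fun v => A (l' v)) (fun v => B (l' v)) (g v) :=
  iSup_congr fun n => h.iterate_stepVal_eq A B (by simp) n v hv

theorem weakUntilVal_eq (h : IsBisimulation p l p' l' N g) (A B : Set AP → Prop) (v : V)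
    (hv : v ∈ N) :
    weakUntilVal p (fun v => A (l v)) (fun v => B (l v)) v =
      weakUntilVal p' (fun v => A (l' v)) (fun v => B (l' v)) (g v) :=
  iInf_congr fun n => h.iterate_stepVal_eq A B (by simp) n v hv

theorem nextVal_eq (h : IsBisimulation p l p' l' N g) (B : Set AP → Prop) (v : V)
    (hv : v ∈ N) :
    nextVal p (fun v => B (l v)) v = nextVal p' (fun v => B (l' v)) (g v) :=
  h.stepVal_eq (fun _ => True) (fun _ => False)
    (fun v hv => h.stepVal_eq (fun _ => False) B (by simp) v hv) v hv

end IsBisimulation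

/-! ### Semantics of flat formulas through values -/

/-- Satisfaction of `P_{⋈ q}(φ)` at a vertex of a labelled weighted graph. -/
def FlatAtom.HoldsIn {V AP : Type*} (p : V → V → ℝ≥0∞) (l : V → Set AP) (v : V) :
    FlatAtom AP → Prop
  | probX b q α => b.toCmp.Holds (nextVal p (fun v => α.HoldsAt (l v)) v).toReal q
  | probU b q α β => b.toCmp.Holds
      (untilVal p (fun v => α.HoldsAt (l v)) (fun v => β.HoldsAt (l v)) v).toReal q
  | probW b q α β => b.toCmp.Holds
      (weakUntilVal p (fun v => α.HoldsAt (l v)) (fun v => β.HoldsAt (l v)) v).toReal q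

/-- Satisfaction of a flat formula at a vertex of a labelled weighted graph. -/
def Flat.HoldsIn {V AP : Type*} (p : V → V → ℝ≥0∞) (l : V → Set AP) (v : V) :
    Flat AP → Prop
  | prob φ => φ.HoldsIn p l v
  | and Φ Ψ => Φ.HoldsIn p l v ∧ Ψ.HoldsIn p l v
  | or Φ Ψ => Φ.HoldsIn p l v ∨ Ψ.HoldsIn p l v

theorem PCTL.sat_or {S AP : Type*} (D : MarkovChain S AP) (Φ Ψ : PCTL AP) (s : S) :
    (Φ.or Ψ).Sat D s ↔ Φ.Sat D s ∨ Ψ.Sat D s := by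
  change ¬ (¬ Φ.Sat D s ∧ ¬ Ψ.Sat D s) ↔ _
  tauto

theorem Literal.sat_toPCTL {S AP : Type*} (D : MarkovChain S AP) (α : Literal AP) (s : S) :
    α.toPCTL.Sat D s ↔ α.HoldsAt (D.label s) := by
  induction α with
  | atom a => rfl
  | neg α ih => exact not_congr ih
  | and α β ihα ihβ => exact and_congr ihα ihβ

theorem Literal.sat_toPCTL_eq {S AP : Type*} (D : MarkovChain S AP) (α : Literal AP) :
    α.toPCTL.Sat D = fun s => α.HoldsAt (D.label s) :=
  funext fun s => propext (α.sat_toPCTL D s)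

theorem FlatAtom.sat_toPCTL {S AP : Type*} [Countable S] (D : MarkovChain S AP)
    (φ : FlatAtom AP) (s : S) :
    φ.toPCTL.Sat D s ↔ φ.HoldsIn (fun s => D.trans s) D.label s := by
  cases φ <;> simp only [toPCTL, PCTL.Sat, HoldsIn, Literal.sat_toPCTL_eq,
    MarkovChain.pr_nextPaths, MarkovChain.pr_untilPaths, MarkovChain.pr_weakUntilPaths]

theorem Flat.sat_toPCTL {S AP : Type*} [Countable S] (D : MarkovChain S AP) (Φ : Flat AP)
    (s : S) : Φ.toPCTL.Sat D s ↔ Φ.HoldsIn (fun s => D.trans s) D.label s := by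
  induction Φ with
  | prob φ => exact φ.sat_toPCTL D s
  | and Φ Ψ ihΦ ihΨ => exact and_congr ihΦ ihΨ
  | or Φ Ψ ihΦ ihΨ => exact (PCTL.sat_or D _ _ s).trans (or_congr ihΦ ihΨ)

namespace IsBisimulation

variable {V W AP : Type*} {p : V → V → ℝ≥0∞} {l : V → Set AP} {p' : W → W → ℝ≥0∞}
  {l' : W → Set AP} {N : Set V} {g : V → W}

theorem flatAtom_holdsIn_iff (h : IsBisimulation p l p' l' N g) (φ : FlatAtom AP) (v : V)
    (hv : v ∈ N) : φ.HoldsIn p l v ↔ φ.HoldsIn p' l' (g v) := by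
  cases φ with
  | probX b q α => simp only [FlatAtom.HoldsIn, h.nextVal_eq (fun L => α.HoldsAt L) v hv]
  | probU b q α β =>
    simp only [FlatAtom.HoldsIn,
      h.untilVal_eq (fun L => α.HoldsAt L) (fun L => β.HoldsAt L) v hv]
  | probW b q α β =>
    simp only [FlatAtom.HoldsIn,
      h.weakUntilVal_eq (fun L => α.HoldsAt L) (fun L => β.HoldsAt L) v hv]

theorem flat_holdsIn_iff (h : IsBisimulation p l p' l' N g) (Φ : Flat AP) (v : V)
    (hv : v ∈ N) : Φ.HoldsIn p l v ↔ Φ.HoldsIn p' l' (g v) := by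
  induction Φ with
  | prob φ => exact h.flatAtom_holdsIn_iff φ v hv
  | and Φ Ψ ihΦ ihΨ => exact and_congr ihΦ ihΨ
  | or Φ Ψ ihΦ ihΨ => exact or_congr ihΦ ihΨ

end IsBisimulation

/-! ### Trees and unfoldings -/

namespace ProbTree

variable {AP : Type*}

/-- The root of a tree. -/
def root (T : ProbTree AP) : List ℕ :=
  [T.existsUnique_root.choose]

theorem root_mem (T : ProbTree AP) : T.root ∈ T.nodes :=
  T.existsUnique_root.choose_spec.1

theorem length_root (T : ProbTree AP) : T.root.length = 1 := rfl

theorem eq_root (T : ProbTree AP) {π : List ℕ} (h : π ∈ T.nodes) (h1 : π.length = 1) :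
    π = T.root := by
  obtain ⟨n, rfl⟩ := List.length_eq_one_iff.1 h1
  rw [root, T.existsUnique_root.choose_spec.2 n h]

theorem ne_nil (T : ProbTree AP) {π : List ℕ} (h : π ∈ T.nodes) : π ≠ [] := by
  rintro rfl
  exact T.nil_notMem h

theorem of_prob_ne_zero (T : ProbTree AP) {π π' : List ℕ} (h : T.prob π π' ≠ 0) :
    π ∈ T.nodes ∧ π' ∈ T.nodes ∧ ∃ n, π' = π ++ [n] :=
  (T.prob_pos_iff π π').1 (pos_iff_ne_zero.2 h)

theorem prob_ne_zero (T : ProbTree AP) {π : List ℕ} {n : ℕ} (h : π ∈ T.nodes)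
    (h' : π ++ [n] ∈ T.nodes) : T.prob π (π ++ [n]) ≠ 0 :=
  pos_iff_ne_zero.1 ((T.prob_pos_iff _ _).2 ⟨h, h', n, rfl⟩)

theorem tsum_prob_le_one (T : ProbTree AP) (π : List ℕ) : ∑' π', T.prob π π' ≤ 1 := by
  by_cases h : ∃ π', T.prob π π' ≠ 0
  · obtain ⟨π', h⟩ := h
    obtain ⟨h1, h2, n, rfl⟩ := T.of_prob_ne_zero h
    exact (T.tsum_prob π h1 ⟨n, h2⟩).le
  · push Not at h
    simp [h]

/-- Parents are nodes. -/
theorem mem_of_append_mem (T : ProbTree AP) {π : List ℕ} {n : ℕ} (h0 : π ≠ [])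
    (h : π ++ [n] ∈ T.nodes) : π ∈ T.nodes :=
  T.prefix_closed _ h π (List.prefix_append _ _) h0

theorem IsTotal.exists_child {T : ProbTree AP} (hT : T.IsTotal) {π : List ℕ}
    (h : π ∈ T.nodes) : ∃ n, π ++ [n] ∈ T.nodes := by
  obtain ⟨π', hπ', ⟨ρ, rfl⟩, hne⟩ := hT π h
  cases ρ with
  | nil => simp at hne
  | cons n ρ =>
    exact ⟨n, T.prefix_closed _ hπ' _ ⟨ρ, by simp⟩ (by simp)⟩

theorem IsTotal.tsum_prob_eq_one {T : ProbTree AP} (hT : T.IsTotal) {π : List ℕ}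
    (h : π ∈ T.nodes) : ∑' π', T.prob π π' = 1 :=
  T.tsum_prob π h (hT.exists_child h)

/-- All weights to sequences that are not nodes vanish, so the sums reduce to nodes and can be
reindexed; the value `[]` of the map elsewhere is arbitrary. -/
theorem isBisimulation_of_equiv {T₁ T₂ : ProbTree AP} (f : T₁.nodes ≃ T₂.nodes)
    (hl : ∀ π, T₂.label (f π) = T₁.label π)
    (hp : ∀ π π', T₂.prob (f π) (f π') = T₁.prob π π') :
    ∃ g : List ℕ → List ℕ, (∀ π : T₁.nodes, g π = f π) ∧
      IsBisimulation T₁.prob T₁.label T₂.prob T₂.label T₁.nodes g := by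
  classical
  refine ⟨fun π => if h : π ∈ T₁.nodes then f ⟨π, h⟩ else [], fun π => by simp, ?_⟩
  refine ⟨fun v _ w hw => (T₁.of_prob_ne_zero hw).2.1, fun v hv => ?_, fun v hv F => ?_⟩
  · simpa [hv] using hl ⟨v, hv⟩
  · rw [← tsum_subtype_eq_of_support_subset (s := T₁.nodes),
      ← tsum_subtype_eq_of_support_subset (s := T₂.nodes), ← f.tsum_eq]
    · refine tsum_congr fun w => ?_
      simp [hv, ← hp ⟨v, hv⟩ w]
    · intro w hw
      exact (T₂.of_prob_ne_zero (left_ne_zero_of_mul hw)).2.1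
    · intro w hw
      exact (T₁.of_prob_ne_zero (left_ne_zero_of_mul hw)).2.1

/-- The root is recognised by having no parent: a parent of its image would pull back along the
isomorphism to a parent of the root. -/
theorem length_equiv_root {T₁ T₂ : ProbTree AP} (f : T₁.nodes ≃ T₂.nodes)
    (hp : ∀ π π', T₂.prob (f π) (f π') = T₁.prob π π') :
    (f ⟨T₁.root, T₁.root_mem⟩ : List ℕ) = T₂.root := by
  set ρ := f ⟨T₁.root, T₁.root_mem⟩ with hρ
  refine T₂.eq_root ρ.2 ?_
  rcases List.eq_nil_or_concat (ρ : List ℕ) with h | ⟨σ, n, h⟩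
  · exact absurd h (T₂.ne_nil ρ.2)
  · rw [List.concat_eq_append] at h
    by_cases hσ : σ = []
    · simp [h, hσ]
    · exfalso
      have hmem : σ ++ [n] ∈ T₂.nodes := h ▸ ρ.2
      have hσmem := T₂.mem_of_append_mem hσ hmem
      have h1 : T₂.prob (f (f.symm ⟨σ, hσmem⟩)) (f ⟨T₁.root, T₁.root_mem⟩) ≠ 0 := by
        rw [← hρ, h, f.apply_symm_apply]
        exact T₂.prob_ne_zero hσmem hmem
      rw [hp] at h1
      obtain ⟨h2, _, m, h3⟩ := T₁.of_prob_ne_zero h1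
      have h4 := congrArg List.length h3
      have h5 := List.length_pos_iff.2 (T₁.ne_nil h2)
      simp only [length_root, List.length_append, List.length_singleton] at h4
      omega

end ProbTree

namespace MarkovChain

variable {AP : Type*}

theorem unfolding_isBisimulation (D : MarkovChain ℕ AP) :
    IsBisimulation D.unfolding.prob D.unfolding.label (fun s => D.trans s) D.label
      D.unfolding.nodes (fun π => π.getLastD D.init) := by
  classical
  refine ⟨fun v _ w hw => (D.unfolding.of_prob_ne_zero hw).2.1, fun v hv => ?_,
    fun v hv f => ?_⟩
  · exact (if_pos hv).symm
  · have hinj : Function.Injective (fun t : ℕ => v ++ [t]) := by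
      intro s t h
      simpa using h
    rw [← hinj.tsum_eq]
    · refine tsum_congr fun t => ?_
      change (if D.IsRun v ∧ _ then _ else _) * _ = _
      rw [if_pos ⟨hv, t, rfl⟩]
      simp
    · intro w hw
      obtain ⟨_, _, t, rfl⟩ := D.unfolding.of_prob_ne_zero (left_ne_zero_of_mul hw)
      exact ⟨t, rfl⟩

theorem root_unfolding (D : MarkovChain ℕ AP) : D.unfolding.root = [D.init] :=
  (D.unfolding.eq_root IsRun.init rfl).symm

end MarkovChain

/-- Two bisimulations in a row, the isomorphism and the map from a run to its last state, carry the
root to the initial state. -/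
theorem ProbTree.Isomorphic.flat_holdsIn_iff {AP : Type*} {T : ProbTree AP}
    {D : MarkovChain ℕ AP} (h : T.Isomorphic D.unfolding) (Φ : Flat AP) :
    Φ.HoldsIn T.prob T.label T.root ↔ Φ.toPCTL.Sat D D.init := by
  obtain ⟨f, hl, hp⟩ := h
  obtain ⟨g, hg, hb⟩ := isBisimulation_of_equiv f hl hp
  rw [hb.flat_holdsIn_iff Φ _ T.root_mem, hg ⟨_, T.root_mem⟩, length_equiv_root f hp,
    D.unfolding_isBisimulation.flat_holdsIn_iff Φ _ D.unfolding.root_mem, D.root_unfolding,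
    Flat.sat_toPCTL]
  rfl

theorem ProbTree.Isomorphic.literal_holdsAt_iff {AP : Type*} {T : ProbTree AP}
    {D : MarkovChain ℕ AP} (h : T.Isomorphic D.unfolding) (α : Literal AP) :
    α.HoldsAt (T.label T.root) ↔ α.toPCTL.Sat D D.init := by
  obtain ⟨f, hl, hp⟩ := h
  rw [Literal.sat_toPCTL, ← hl ⟨_, T.root_mem⟩, length_equiv_root f hp,
    ← D.unfolding_isBisimulation.label _ D.unfolding.root_mem, D.root_unfolding]
  rfl

namespace ProbTree

variable {AP : Type*}

/-! ### Total trees as unfoldings -/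

/-- An encoding of finite sequences. -/
def nodeCode : List ℕ ≃ ℕ := Denumerable.eqv (List ℕ)

open Classical in
/-- The Markov chain whose states are the (encoded) nodes of a total tree. -/
def toMarkovChain (T : ProbTree AP) (hT : T.IsTotal) : MarkovChain ℕ AP where
  trans s :=
    if h : nodeCode.symm s ∈ T.nodes then
      ⟨fun t => T.prob (nodeCode.symm s) (nodeCode.symm t), by
        rw [ENNReal.summable.hasSum_iff,
          nodeCode.symm.tsum_eq (fun π => T.prob (nodeCode.symm s) π)]
        exact hT.tsum_prob_eq_one h⟩
    -- Codes of non-nodes are unreachable, so any distribution will do.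
    else PMF.pure 0
  label s := T.label (nodeCode.symm s)
  init := nodeCode T.root

section

variable (T : ProbTree AP) (hT : T.IsTotal)

theorem toMarkovChain_trans {s : ℕ} (h : nodeCode.symm s ∈ T.nodes) (t : ℕ) :
    (T.toMarkovChain hT).trans s t = T.prob (nodeCode.symm s) (nodeCode.symm t) := by
  classical
  exact congrArg (fun μ : PMF ℕ => μ t) (dif_pos h)

/-- The node at which a run of `T.toMarkovChain` ends. -/
def runEnd (r : List ℕ) : List ℕ :=
  nodeCode.symm (r.getLastD (T.toMarkovChain hT).init)

theorem runEnd_append (r : List ℕ) (t : ℕ) : T.runEnd hT (r ++ [t]) = nodeCode.symm t := by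
  simp [runEnd]

theorem runEnd_init : T.runEnd hT [(T.toMarkovChain hT).init] = T.root := by
  simp [runEnd, toMarkovChain]

theorem runEnd_mem {r : List ℕ} (h : (T.toMarkovChain hT).IsRun r) :
    T.runEnd hT r ∈ T.nodes := by
  induction h with
  | init => rw [runEnd_init]; exact T.root_mem
  | step r t hr ht ih =>
    rw [PMF.mem_support_iff, toMarkovChain_trans _ _ ih] at ht
    rw [runEnd_append]
    exact (T.of_prob_ne_zero ht).2.1

theorem runEnd_step {r : List ℕ} {t : ℕ} (h : (T.toMarkovChain hT).IsRun r)
    (ht : t ∈ ((T.toMarkovChain hT).trans (r.getLastD (T.toMarkovChain hT).init)).support) :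
    ∃ n, T.runEnd hT (r ++ [t]) = T.runEnd hT r ++ [n] := by
  rw [PMF.mem_support_iff, toMarkovChain_trans _ _ (T.runEnd_mem hT h)] at ht
  rw [runEnd_append]
  exact (T.of_prob_ne_zero ht).2.2

theorem isRun_step {r : List ℕ} {n : ℕ} (h : (T.toMarkovChain hT).IsRun r)
    (hn : T.runEnd hT r ++ [n] ∈ T.nodes) :
    (T.toMarkovChain hT).IsRun (r ++ [nodeCode (T.runEnd hT r ++ [n])]) := by
  refine .step r _ h ?_
  rw [PMF.mem_support_iff, toMarkovChain_trans _ _ (T.runEnd_mem hT h),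
    Equiv.symm_apply_apply]
  exact T.prob_ne_zero (T.runEnd_mem hT h) hn

/-- A node determines its parent, so the end of a run determines the whole run backwards; only the
initial run ends in the root, as each step lengthens the node. -/
theorem runEnd_inj {r r' : List ℕ} (h : (T.toMarkovChain hT).IsRun r)
    (h' : (T.toMarkovChain hT).IsRun r') (he : T.runEnd hT r = T.runEnd hT r') : r = r' := by
  have hroot : ∀ (r : List ℕ) (t : ℕ), (T.toMarkovChain hT).IsRun r →
      t ∈ ((T.toMarkovChain hT).trans (r.getLastD (T.toMarkovChain hT).init)).support →
      T.root ≠ T.runEnd hT (r ++ [t]) := by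
    intro r t hr ht h
    obtain ⟨n, hn⟩ := T.runEnd_step hT hr ht
    have h1 := congrArg List.length (h.trans hn)
    have h2 := List.length_pos_iff.2 (T.ne_nil (T.runEnd_mem hT hr))
    simp only [length_root, List.length_append, List.length_singleton] at h1
    omega
  induction h generalizing r' with
  | init =>
    cases h' with
    | init => rfl
    | step r t hr ht =>
      rw [runEnd_init] at he
      exact absurd he (hroot r t hr ht)
  | step r t hr ht ih =>
    cases h' with
    | init =>
      rw [runEnd_init] at he
      exact absurd he.symm (hroot r t hr ht)
    | step r' t' hr' ht' =>
      obtain ⟨n, hn⟩ := T.runEnd_step hT hr ht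
      obtain ⟨n', hn'⟩ := T.runEnd_step hT hr' ht'
      have h1 := hn.symm.trans (he.trans hn')
      rw [ih hr' (List.append_inj' h1 rfl).1]
      rw [runEnd_append, runEnd_append] at he
      rw [nodeCode.symm.injective he]

theorem exists_runEnd_eq (π : List ℕ) (h : π ∈ T.nodes) :
    ∃ r, (T.toMarkovChain hT).IsRun r ∧ T.runEnd hT r = π := by
  induction π using List.reverseRecOn with
  | nil => exact absurd h T.nil_notMem
  | append_singleton π n ih =>
    by_cases h0 : π = []
    · refine ⟨_, .init, ?_⟩
      rw [runEnd_init]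
      exact (T.eq_root h (by simp [h0])).symm
    · obtain ⟨r, hr, rfl⟩ := ih (T.mem_of_append_mem h0 h)
      exact ⟨_, T.isRun_step hT hr h, by rw [runEnd_append, Equiv.symm_apply_apply]⟩

theorem isomorphic_unfolding_toMarkovChain :
    T.Isomorphic (T.toMarkovChain hT).unfolding := by
  classical
  let g : (T.toMarkovChain hT).unfolding.nodes → T.nodes :=
    fun r => ⟨T.runEnd hT r, T.runEnd_mem hT r.2⟩
  have hg : Function.Bijective g := by
    constructor
    · intro r r' h
      exact Subtype.ext (T.runEnd_inj hT r.2 r'.2 (congrArg Subtype.val h))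
    · rintro ⟨π, hπ⟩
      obtain ⟨r, hr, h⟩ := T.exists_runEnd_eq hT π hπ
      exact ⟨⟨r, hr⟩, Subtype.ext h⟩
  let e := Equiv.ofBijective g hg
  refine ⟨e.symm, fun π => ?_, fun π π' => ?_⟩
  · obtain ⟨r, rfl⟩ := e.surjective π
    rw [e.symm_apply_apply]
    exact if_pos r.2
  · obtain ⟨r, rfl⟩ := e.surjective π
    obtain ⟨r', rfl⟩ := e.surjective π'
    rw [e.symm_apply_apply, e.symm_apply_apply]
    change (if (T.toMarkovChain hT).IsRun r ∧ _ then _ else _) =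
      T.prob (T.runEnd hT r) (T.runEnd hT r')
    by_cases h : ∃ t, (r' : List ℕ) = (r : List ℕ) ++ [t]
    · rw [if_pos ⟨r.2, h⟩]
      exact T.toMarkovChain_trans hT (T.runEnd_mem hT r.2) _
    · rw [if_neg fun h' => h h'.2]
      by_contra hne
      obtain ⟨_, h2, n, hn⟩ := T.of_prob_ne_zero (Ne.symm hne)
      refine h ⟨_, T.runEnd_inj hT r'.2 (T.isRun_step hT r.2 (hn ▸ h2)) ?_⟩
      rw [runEnd_append, Equiv.symm_apply_apply, hn]

end

/-! ### Prefixes -/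

theorem IsPrefix.trans {T₁ T₂ T₃ : ProbTree AP} (h : T₁.IsPrefix T₂) (h' : T₂.IsPrefix T₃) :
    T₁.IsPrefix T₃ :=
  ⟨h.1.trans h'.1, fun π hπ => (h'.2.1 π (h.1 hπ)).trans (h.2.1 π hπ),
    fun π hπ π' hπ' => (h'.2.2 π (h.1 hπ) π' (h.1 hπ')).trans (h.2.2 π hπ π' hπ')⟩

theorem IsPrefix.root_eq {T₁ T₂ : ProbTree AP} (h : T₁.IsPrefix T₂) : T₁.root = T₂.root :=
  T₂.eq_root (h.1 T₁.root_mem) rfl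

/-- A prefix prescribes only the edges between its own nodes, but at a non-leaf these already have
total mass one and leave no room for further children. -/
theorem IsPrefix.prob_eq {T₁ T₂ : ProbTree AP} (h : T₁.IsPrefix T₂) {π : List ℕ}
    (hπ : π ∈ T₁.nodes) (hc : ∃ n, π ++ [n] ∈ T₁.nodes) (π' : List ℕ) :
    T₂.prob π π' = T₁.prob π π' := by
  have hle : ∀ π', T₁.prob π π' ≤ T₂.prob π π' := by
    intro π'
    by_cases h0 : T₁.prob π π' = 0
    · simp [h0]
    · exact (h.2.2 π hπ π' (T₁.of_prob_ne_zero h0).2.1).ge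
  have hs := T₁.tsum_prob π hπ hc
  obtain ⟨n, hn⟩ := hc
  by_contra hne
  have := ENNReal.tsum_lt_tsum (by rw [hs]; exact ENNReal.one_ne_top) hle
    (lt_of_le_of_ne (hle π') (Ne.symm hne))
  rw [hs, T₂.tsum_prob π (h.1 hπ) ⟨n, h.1 hn⟩] at this
  exact lt_irrefl _ this

/-- The expansion operator of a tree, for `A` and `B` depending on the labels. -/
def step (T : ProbTree AP) (A B : Set AP → Prop) : (List ℕ → ℝ≥0∞) → List ℕ → ℝ≥0∞ :=
  stepVal T.prob (fun π => A (T.label π)) (fun π => B (T.label π))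

theorem IsPrefix.step_eq {T₁ T₂ : ProbTree AP} (h : T₁.IsPrefix T₂) (A B : Set AP → Prop)
    {f g : List ℕ → ℝ≥0∞} {π : List ℕ} (hπ : π ∈ T₁.nodes) (hc : ∃ n, π ++ [n] ∈ T₁.nodes)
    (hfg : ∀ n, π ++ [n] ∈ T₁.nodes → f (π ++ [n]) = g (π ++ [n])) :
    T₁.step A B f π = T₂.step A B g π := by
  refine stepVal_congr (by rw [h.2.1 π hπ]) (by rw [h.2.1 π hπ]) (tsum_congr fun π' => ?_)
  rw [h.prob_eq hπ hc]
  by_cases h0 : T₁.prob π π' = 0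
  · simp [h0]
  · obtain ⟨_, hmem, n, rfl⟩ := T₁.of_prob_ne_zero h0
    rw [hfg n hmem]

/-- The k expansions take place at nodes of length at most n, where `T₁` has no leaves, and the
starting valuation is read at length at most n + 1. -/
theorem IsPrefix.iterate_step_eq {T₁ T₂ : ProbTree AP} (h : T₁.IsPrefix T₂)
    (A B : Set AP → Prop) {f g : List ℕ → ℝ≥0∞} {n : ℕ}
    (hc : ∀ π ∈ T₁.nodes, π.length ≤ n → ∃ m, π ++ [m] ∈ T₁.nodes)
    (hfg : ∀ π ∈ T₁.nodes, f π = g π) (k : ℕ) {π : List ℕ} (hπ : π ∈ T₁.nodes)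
    (hk : π.length + k ≤ n + 1) : (T₁.step A B)^[k] f π = (T₂.step A B)^[k] g π := by
  induction k generalizing π with
  | zero => exact hfg π hπ
  | succ k ih =>
    rw [Function.iterate_succ_apply', Function.iterate_succ_apply']
    refine h.step_eq A B hπ (hc π hπ (by omega)) fun m hm => ih hm ?_
    simp only [List.length_append, List.length_singleton]
    omega

/-- Averaging a constant over a distribution changes nothing, so only the label of the node counts.
The one-vertex graph is a form of this value that no longer mentions the tree. -/
theorem IsTotal.step_const {T : ProbTree AP} (hT : T.IsTotal) (A B : Set AP → Prop)
    (c : ℝ≥0∞) {π : List ℕ} (hπ : π ∈ T.nodes) :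
    T.step A B (fun _ => c) π =
      stepVal (fun _ _ : Unit => 1) (fun _ => A (T.label π)) (fun _ => B (T.label π))
        (fun _ => c) () := by
  refine stepVal_congr Iff.rfl Iff.rfl ?_
  rw [ENNReal.tsum_mul_right, hT.tsum_prob_eq_one hπ]
  simp

open Classical in
/-- The prefix of a tree that consists of the nodes of length at most `n + 1`. -/
def cut (n : ℕ) (T : ProbTree AP) : ProbTree AP where
  nodes := {π | π ∈ T.nodes ∧ π.length ≤ n + 1}
  label π := if π.length ≤ n + 1 then T.label π else ∅
  prob π π' := if π'.length ≤ n + 1 then T.prob π π' else 0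
  nil_notMem h := T.nil_notMem h.1
  existsUnique_root := by
    obtain ⟨m, hm, hu⟩ := T.existsUnique_root
    exact ⟨m, ⟨hm, by simp⟩, fun k hk => hu k hk.1⟩
  prefix_closed π hπ π' hp h0 := ⟨T.prefix_closed π hπ.1 π' hp h0, hp.length_le.trans hπ.2⟩
  label_of_notMem π hπ := by
    split_ifs with h
    · exact T.label_of_notMem π fun h' => hπ ⟨h', h⟩
    · rfl
  prob_pos_iff π π' := by
    split_ifs with h
    · rw [T.prob_pos_iff]
      constructor
      · rintro ⟨h1, h2, k, rfl⟩
        refine ⟨⟨h1, ?_⟩, ⟨h2, h⟩, k, rfl⟩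
        simp only [List.length_append, List.length_singleton] at h
        omega
      · rintro ⟨h1, h2, h3⟩
        exact ⟨h1.1, h2.1, h3⟩
    · simp only [lt_self_iff_false, false_iff]
      rintro ⟨_, h2, _⟩
      exact h h2.2
  tsum_prob := by
    rintro π hπ ⟨k, hk⟩
    rw [← T.tsum_prob π hπ.1 ⟨k, hk.1⟩]
    refine tsum_congr fun π' => ?_
    split_ifs with h
    · rfl
    · by_contra hne
      obtain ⟨_, _, m, rfl⟩ := T.of_prob_ne_zero (Ne.symm hne)
      have := hk.2
      simp only [List.length_append, List.length_singleton] at h this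
      omega

theorem cut_isPrefix (n : ℕ) (T : ProbTree AP) : (T.cut n).IsPrefix T :=
  ⟨fun _ h => h.1, fun _ h => (if_pos h.2).symm, fun _ _ _ h => (if_pos h.2).symm⟩

theorem cut_isFiniteDepth (n : ℕ) (T : ProbTree AP) : (T.cut n).IsFiniteDepth :=
  ⟨n + 1, fun _ h => h.2⟩

theorem IsPrefix.isPrefix_cut {T₁ T : ProbTree AP} (h : T₁.IsPrefix T) {n : ℕ}
    (hn : ∀ π ∈ T₁.nodes, π.length ≤ n + 1) : T₁.IsPrefix (T.cut n) :=
  ⟨fun π hπ => ⟨h.1 hπ, hn π hπ⟩, fun π hπ => (if_pos (hn π hπ)).trans (h.2.1 π hπ),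
    fun π hπ π' hπ' => (if_pos (hn π' hπ')).trans (h.2.2 π hπ π' hπ')⟩

theorem IsTotal.exists_child_cut {T : ProbTree AP} (hT : T.IsTotal) {n : ℕ} :
    ∀ π ∈ (T.cut n).nodes, π.length ≤ n → ∃ m, π ++ [m] ∈ (T.cut n).nodes := by
  intro π hπ hn
  obtain ⟨m, hm⟩ := hT.exists_child hπ.1
  exact ⟨m, hm, by simpa using hn⟩

/-- The first `n + 1` expansions of a constant at the root only depend on `T.cut n`. -/
theorem IsTotal.iterate_step_root_eq {T T₂ : ProbTree AP} (hT : T.IsTotal) (hT₂ : T₂.IsTotal)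
    {n : ℕ} (h : (T.cut n).IsPrefix T₂) (A B : Set AP → Prop) (c : ℝ≥0∞) :
    (T.step A B)^[n + 1] (fun _ => c) T.root = (T₂.step A B)^[n + 1] (fun _ => c) T₂.root := by
  -- The innermost expansion is split off: at the leaves of the cut it depends on the label alone.
  -- The other n expansions stay above the leaves.
  rw [Function.iterate_succ_apply, Function.iterate_succ_apply]
  have hk : (T.cut n).root.length + n ≤ n + 1 := by rw [length_root]; omega
  rw [← (cut_isPrefix n T).root_eq, ← h.root_eq,
    ← (cut_isPrefix n T).iterate_step_eq A B hT.exists_child_cut (fun _ _ => rfl) n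
      (root_mem _) hk]
  refine h.iterate_step_eq A B hT.exists_child_cut (fun π hπ => ?_) n (root_mem _) hk
  rw [hT.step_const A B c hπ.1, hT₂.step_const A B c (h.1 hπ), h.2.1 π hπ,
    (cut_isPrefix n T).2.1 π hπ]

/-- Only labels at length 2 matter; the cut keeps length 3 so that these nodes have children, as
`step_eq` requires. -/
theorem IsTotal.nextVal_root_eq {T : ProbTree AP} (hT : T.IsTotal) {T₂ : ProbTree AP}
    (h : (T.cut 2).IsPrefix T₂) (B : Set AP → Prop) :
    nextVal T.prob (fun π => B (T.label π)) T.root =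
      nextVal T₂.prob (fun π => B (T₂.label π)) T₂.root := by
  have key : ∀ {T₂ : ProbTree AP} (_ : (T.cut 2).IsPrefix T₂),
      nextVal (T.cut 2).prob (fun π => B ((T.cut 2).label π)) (T.cut 2).root =
        nextVal T₂.prob (fun π => B (T₂.label π)) T₂.root := by
    intro T₂ h
    rw [← h.root_eq]
    refine h.step_eq (fun _ => True) (fun _ => False) (root_mem _)
      (hT.exists_child_cut _ (root_mem _) (by rw [length_root]; omega)) fun n hn => ?_
    refine h.step_eq (fun _ => False) B hn (hT.exists_child_cut _ hn ?_) fun _ _ => rfl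
    simp [length_root]
  rw [← key (cut_isPrefix 2 T), key h]

/-- The value of `A U B` at the root. -/
def untilRoot (T : ProbTree AP) (A B : Set AP → Prop) : ℝ≥0∞ :=
  untilVal T.prob (fun π => A (T.label π)) (fun π => B (T.label π)) T.root

/-- The value of `A W B` at the root. -/
def weakUntilRoot (T : ProbTree AP) (A B : Set AP → Prop) : ℝ≥0∞ :=
  weakUntilVal T.prob (fun π => A (T.label π)) (fun π => B (T.label π)) T.root

theorem iterate_step_zero_le_untilRoot (T : ProbTree AP) (A B : Set AP → Prop) (n : ℕ) :
    (T.step A B)^[n] (fun _ => 0) T.root ≤ T.untilRoot A B :=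
  le_iSup (fun n => (T.step A B)^[n] (fun _ => 0) T.root) n

theorem weakUntilRoot_le_iterate_step_one (T : ProbTree AP) (A B : Set AP → Prop) (n : ℕ) :
    T.weakUntilRoot A B ≤ (T.step A B)^[n] (fun _ => 1) T.root :=
  iInf_le (fun n => (T.step A B)^[n] (fun _ => 1) T.root) n

theorem untilRoot_le_weakUntilRoot (T : ProbTree AP) (A B : Set AP → Prop) :
    T.untilRoot A B ≤ T.weakUntilRoot A B :=
  untilVal_le_weakUntilVal T.tsum_prob_le_one _ _ _

theorem weakUntilRoot_le_one (T : ProbTree AP) (A B : Set AP → Prop) :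
    T.weakUntilRoot A B ≤ 1 :=
  weakUntilVal_le_one _ _ _ _

/-- Iterated expansions are monotone in the values at the nodes of a fixed length. -/
theorem iterate_step_le_iterate_step (T : ProbTree AP) (A B : Set AP → Prop)
    {f g : List ℕ → ℝ≥0∞} {n : ℕ} (hfg : ∀ π ∈ T.nodes, π.length = n → f π ≤ g π) (k : ℕ)
    {π : List ℕ} (hπ : π ∈ T.nodes) (hk : π.length + k = n) :
    (T.step A B)^[k] f π ≤ (T.step A B)^[k] g π := by
  induction k generalizing π with
  | zero => exact hfg π hπ hk
  | succ k ih =>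
    rw [Function.iterate_succ_apply', Function.iterate_succ_apply']
    unfold step stepVal
    split_ifs
    · exact le_rfl
    · refine ENNReal.tsum_le_tsum fun π' => ?_
      by_cases h0 : T.prob π π' = 0
      · simp [h0]
      · obtain ⟨_, hmem, m, rfl⟩ := T.of_prob_ne_zero h0
        refine mul_le_mul_right (ih hmem ?_) _
        simp only [List.length_append, List.length_singleton]
        omega
    · exact le_rfl

/-- If the nodes of some length satisfy `B` or violate `A`, then `A U B` and `A W B` have the same
value. -/
theorem weakUntilRoot_le_untilRoot (T : ProbTree AP) (A B : Set AP → Prop) (n : ℕ)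
    (h : ∀ π ∈ T.nodes, π.length = n + 1 → B (T.label π) ∨ ¬ A (T.label π)) :
    T.weakUntilRoot A B ≤ T.untilRoot A B := by
  refine (T.weakUntilRoot_le_iterate_step_one A B (n + 1)).trans
    (le_trans ?_ (T.iterate_step_zero_le_untilRoot A B (n + 1)))
  -- The innermost expansion happens at length n + 1, where the label alone decides the result, so
  -- starting from 1 or from 0 is the same.
  rw [Function.iterate_succ_apply, Function.iterate_succ_apply]
  refine T.iterate_step_le_iterate_step A B (n := n + 1) (fun π hπ hn => ?_) n T.root_mem
    (by rw [length_root]; omega)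
  rcases h π hπ hn with hB | hA
  · simp [step, stepVal, hB]
  · simp [step, stepVal, hA]

/-- If the nodes of length `n + 2` satisfy `B`, then the paths that have not failed after `n + 1`
steps satisfy `A U B`. -/
theorem iterate_step_one_le_untilRoot (T : ProbTree AP) (A B : Set AP → Prop) (n : ℕ)
    (h : ∀ π ∈ T.nodes, π.length = n + 2 → B (T.label π)) :
    (T.step A B)^[n + 1] (fun _ => 1) T.root ≤ T.untilRoot A B := by
  refine le_trans ?_ (T.iterate_step_zero_le_untilRoot A B (n + 2))
  -- The root has length 1, so n + 1 expansions lead to length n + 2, where one more expansion of 0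
  -- already gives 1.
  rw [Function.iterate_succ_apply _ (n + 1)]
  refine T.iterate_step_le_iterate_step A B (n := n + 2) (fun π hπ hn => ?_) (n + 1) T.root_mem
    (by rw [length_root]; omega)
  simp [step, stepVal, h π hπ hn]

/-- If the nodes of length `n + 2` violate `A` and `B`, then the paths that have not succeeded
after `n + 1` steps violate `A W B`. -/
theorem weakUntilRoot_le_iterate_step_zero (T : ProbTree AP) (A B : Set AP → Prop) (n : ℕ)
    (h : ∀ π ∈ T.nodes, π.length = n + 2 → ¬ A (T.label π) ∧ ¬ B (T.label π)) :
    T.weakUntilRoot A B ≤ (T.step A B)^[n + 1] (fun _ => 0) T.root := by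
  refine (T.weakUntilRoot_le_iterate_step_one A B (n + 2)).trans ?_
  -- Dually, one more expansion of 1 at length n + 2 gives 0.
  rw [Function.iterate_succ_apply _ (n + 1)]
  refine T.iterate_step_le_iterate_step A B (n := n + 2) (fun π hπ hn => ?_) (n + 1) T.root_mem
    (by rw [length_root]; omega)
  simp [step, stepVal, h π hπ hn]

/-! ### Extending a tree by paths -/

/-- The nodes that are reached from a leaf by appending zeros. -/
inductive IsTail (T : ProbTree AP) : List ℕ → Prop
  | leaf (π : List ℕ) : π ∈ T.nodes → (∀ n, π ++ [n] ∉ T.nodes) → IsTail T π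
  | snoc (π : List ℕ) : IsTail T π → IsTail T (π ++ [0])

theorem IsTail.ne_nil {T : ProbTree AP} {π : List ℕ} (h : T.IsTail π) : π ≠ [] := by
  cases h with
  | leaf _ h _ => exact T.ne_nil h
  | snoc π _ => simp

/-- Guarantees that the paths to be attached never run back into `T`. -/
theorem IsTail.append_notMem {T : ProbTree AP} {π : List ℕ} (h : T.IsTail π) (n : ℕ) :
    π ++ [n] ∉ T.nodes := by
  induction h generalizing n with
  | leaf _ _ h => exact h n
  | snoc π _ ih =>
    intro h
    exact ih 0 (T.mem_of_append_mem (by simp) h)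

theorem IsTail.of_append {T : ProbTree AP} {π : List ℕ} {n : ℕ} (h : T.IsTail (π ++ [n])) :
    π ++ [n] ∈ T.nodes ∨ T.IsTail π ∧ n = 0 := by
  generalize hl : π ++ [n] = l at h
  cases h with
  | leaf _ h _ => exact Or.inl h
  | snoc π' h =>
    obtain ⟨rfl, h2⟩ := List.append_inj' hl rfl
    exact Or.inr ⟨h, by simpa using h2⟩

theorem exists_child_of_not_isTail {T : ProbTree AP} {π : List ℕ}
    (h : π ∈ T.nodes ∨ T.IsTail π) (ht : ¬ T.IsTail π) :
    π ∈ T.nodes ∧ ∃ n, π ++ [n] ∈ T.nodes := by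
  have hπ := h.resolve_right ht
  refine ⟨hπ, ?_⟩
  by_contra hc
  push Not at hc
  exact ht (.leaf π hπ hc)

open Classical in
/-- The total tree in which each leaf of `T` is followed by an infinite path, where the new nodes
of length `n` have the label `L n`. -/
def extend (T : ProbTree AP) (L : ℕ → Set AP) : ProbTree AP where
  nodes := {π | π ∈ T.nodes ∨ T.IsTail π}
  -- A leaf of `T` is also a tail; testing for nodes of `T` first lets it keep its label.
  label π := if π ∈ T.nodes then T.label π else if T.IsTail π then L π.length else ∅
  prob π π' := if T.IsTail π then if π' = π ++ [0] then 1 else 0 else T.prob π π'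
  nil_notMem h := h.elim T.nil_notMem fun h => h.ne_nil rfl
  existsUnique_root := by
    obtain ⟨m, hm, hu⟩ := T.existsUnique_root
    refine ⟨m, Or.inl hm, fun k hk => hu k ?_⟩
    rcases hk with hk | hk
    · exact hk
    · exact (IsTail.of_append (π := []) hk).resolve_right fun h => h.1.ne_nil rfl
  prefix_closed := by
    rintro π (hπ | hπ) π' hp h0
    · exact Or.inl (T.prefix_closed π hπ π' hp h0)
    · induction hπ with
      | leaf π hπ _ => exact Or.inl (T.prefix_closed π hπ π' hp h0)
      | snoc π hπ ih =>
        rcases List.prefix_concat_iff.1 hp with rfl | hp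
        · exact Or.inr (.snoc π hπ)
        · exact ih hp
  label_of_notMem π h := by
    rw [if_neg fun h' => h (Or.inl h'), if_neg fun h' => h (Or.inr h')]
  prob_pos_iff π π' := by
    by_cases ht : T.IsTail π
    · rw [if_pos ht]
      constructor
      · intro h
        split_ifs at h with h'
        · subst h'
          exact ⟨Or.inr ht, Or.inr (.snoc π ht), 0, rfl⟩
        · simp at h
      · rintro ⟨_, h2, n, rfl⟩
        have h3 : T.IsTail (π ++ [n]) := h2.resolve_left (ht.append_notMem n)
        obtain ⟨_, rfl⟩ := h3.of_append.resolve_left (ht.append_notMem n)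
        simp
    · rw [if_neg ht, T.prob_pos_iff]
      constructor
      · rintro ⟨h1, h2, h3⟩
        exact ⟨Or.inl h1, Or.inl h2, h3⟩
      · rintro ⟨h1, h2, n, rfl⟩
        refine ⟨h1.resolve_right ht, ?_, n, rfl⟩
        rcases h2 with h2 | h2
        · exact h2
        · exact h2.of_append.resolve_right fun h => ht h.1
  tsum_prob := by
    rintro π hπ -
    by_cases ht : T.IsTail π
    · simp [ht]
    · simp only [if_neg ht]
      obtain ⟨h1, h2⟩ := exists_child_of_not_isTail hπ ht
      exact T.tsum_prob π h1 h2

theorem extend_isTotal (T : ProbTree AP) (L : ℕ → Set AP) : (T.extend L).IsTotal := by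
  intro π hπ
  by_cases ht : T.IsTail π
  · exact ⟨π ++ [0], Or.inr (.snoc π ht), List.prefix_append _ _, by simp⟩
  · obtain ⟨_, n, hn⟩ := exists_child_of_not_isTail hπ ht
    exact ⟨π ++ [n], Or.inl hn, List.prefix_append _ _, by simp⟩

theorem isPrefix_extend (T : ProbTree AP) (L : ℕ → Set AP) : T.IsPrefix (T.extend L) := by
  classical
  refine ⟨fun _ h => Or.inl h, fun _ h => if_pos h, fun π hπ π' hπ' => ?_⟩
  change (if T.IsTail π then _ else _) = _
  split_ifs with ht h
  · exact absurd (h ▸ hπ') (ht.append_notMem 0)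
  · by_contra hne
    obtain ⟨_, h2, n, rfl⟩ := T.of_prob_ne_zero (Ne.symm hne)
    exact ht.append_notMem n h2
  · rfl

theorem extend_label (T : ProbTree AP) (L : ℕ → Set AP) {π : List ℕ}
    (hπ : π ∈ (T.extend L).nodes) (h : π ∉ T.nodes) : (T.extend L).label π = L π.length :=
  (if_neg h).trans (if_pos (hπ.resolve_left h))

end ProbTree

variable {AP : Type*}

/-! ### The closure operator -/

/-- Every finite-depth prefix is a prefix of a sufficiently deep cut. -/
theorem mem_propertyClosure_iff (P : Set (TotalTree AP)) (T : TotalTree AP) :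
    T ∈ propertyClosure P ↔ ∀ n, ∃ T₂ ∈ P, (T.1.cut n).IsPrefix T₂.1 := by
  constructor
  · intro h n
    exact h _ ⟨T.1.cut_isFiniteDepth n, T.1.cut_isPrefix n⟩
  · rintro h T₁ ⟨⟨n, hn⟩, hp⟩
    obtain ⟨T₂, hT₂, h2⟩ := h n
    exact ⟨T₂, hT₂, (hp.isPrefix_cut fun π hπ => (hn π hπ).trans n.le_succ).trans h2⟩

theorem subset_propertyClosure (P : Set (TotalTree AP)) : P ⊆ propertyClosure P :=
  fun T hT => (mem_propertyClosure_iff P T).2 fun n => ⟨T, hT, T.1.cut_isPrefix n⟩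

theorem propertyClosure_mono {P Q : Set (TotalTree AP)} (h : P ⊆ Q) :
    propertyClosure P ⊆ propertyClosure Q := by
  intro T hT T₁ hT₁
  obtain ⟨T₂, h2, hp⟩ := hT T₁ hT₁
  exact ⟨T₂, h h2, hp⟩

theorem propertyClosure_empty : propertyClosure (∅ : Set (TotalTree AP)) = ∅ := by
  refine Set.eq_empty_of_forall_notMem fun T hT => ?_
  obtain ⟨_, h, _⟩ := (mem_propertyClosure_iff _ T).1 hT 0
  exact h

/-- If one cut has no extension in P and another none in Q, the deeper of the two has none in
either. -/
theorem propertyClosure_union (P Q : Set (TotalTree AP)) :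
    propertyClosure (P ∪ Q) = propertyClosure P ∪ propertyClosure Q := by
  refine Set.Subset.antisymm (fun T hT => ?_) (Set.union_subset
    (propertyClosure_mono Set.subset_union_left) (propertyClosure_mono Set.subset_union_right))
  by_contra hc
  rw [Set.mem_union, not_or, mem_propertyClosure_iff, mem_propertyClosure_iff] at hc
  obtain ⟨hP, hQ⟩ := hc
  push Not at hP hQ
  obtain ⟨n, hn⟩ := hP
  obtain ⟨m, hm⟩ := hQ
  have hcut : ∀ k ≤ max n m, (T.1.cut k).IsPrefix (T.1.cut (max n m)) := fun k hk =>
    (T.1.cut_isPrefix k).isPrefix_cut fun π hπ => hπ.2.trans (Nat.succ_le_succ hk)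
  obtain ⟨T₂, hT₂ | hT₂, hp⟩ := (mem_propertyClosure_iff _ T).1 hT (max n m)
  · exact hn T₂ hT₂ ((hcut n (le_max_left _ _)).trans hp)
  · exact hm T₂ hT₂ ((hcut m (le_max_right _ _)).trans hp)

theorem propertyClosure_inter_eq {P Q : Set (TotalTree AP)} (hP : propertyClosure P = P)
    (hQ : propertyClosure Q = Q) : propertyClosure (P ∩ Q) = P ∩ Q := by
  refine Set.Subset.antisymm (Set.subset_inter ?_ ?_) (subset_propertyClosure _)
  · exact (propertyClosure_mono Set.inter_subset_left).trans hP.le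
  · exact (propertyClosure_mono Set.inter_subset_right).trans hQ.le

theorem isSafe_of_propertyClosure_eq {P : Set (TotalTree AP)} (h : propertyClosure P = P) :
    IsSafe P :=
  fun T => (Set.ext_iff.1 h T).symm

/-! ### Properties of formulas -/

theorem PCTL.property_or (Φ Ψ : PCTL AP) : (Φ.or Ψ).property = Φ.property ∪ Ψ.property := by
  ext T
  constructor
  · rintro ⟨D, h, hi⟩
    rcases (PCTL.sat_or D Φ Ψ _).1 h with h | h
    · exact Or.inl ⟨D, h, hi⟩
    · exact Or.inr ⟨D, h, hi⟩
  · rintro (⟨D, h, hi⟩ | ⟨D, h, hi⟩)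
    · exact ⟨D, (PCTL.sat_or D Φ Ψ _).2 (Or.inl h), hi⟩
    · exact ⟨D, (PCTL.sat_or D Φ Ψ _).2 (Or.inr h), hi⟩

theorem PCTL.property_mono {Φ Ψ : PCTL AP}
    (h : ∀ D : MarkovChain ℕ AP, Φ.Sat D D.init → Ψ.Sat D D.init) :
    Φ.property ⊆ Ψ.property := by
  rintro T ⟨D, hD, hi⟩
  exact ⟨D, h D hD, hi⟩

theorem Literal.mem_property_iff (α : Literal AP) (T : TotalTree AP) :
    T ∈ α.toPCTL.property ↔ α.HoldsAt (T.1.label T.1.root) := by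
  constructor
  · rintro ⟨D, h, hi⟩
    exact (hi.literal_holdsAt_iff α).2 h
  · intro h
    have hi := T.1.isomorphic_unfolding_toMarkovChain T.2
    exact ⟨_, (hi.literal_holdsAt_iff α).1 h, hi⟩

/-- Isomorphism invariance gives one direction; for the other, the chain on the nodes of the tree is
the witness. -/
theorem Flat.mem_property_iff (Φ : Flat AP) (T : TotalTree AP) :
    T ∈ Φ.toPCTL.property ↔ Φ.HoldsIn T.1.prob T.1.label T.1.root := by
  constructor
  · rintro ⟨D, h, hi⟩
    exact (hi.flat_holdsIn_iff Φ).2 h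
  · intro h
    have hi := T.1.isomorphic_unfolding_toMarkovChain T.2
    exact ⟨_, (hi.flat_holdsIn_iff Φ).1 h, hi⟩

/-- The two memberships may come from different chains; reading both off the tree makes them
compatible. -/
theorem Flat.property_and (Φ Ψ : Flat AP) :
    (Φ.and Ψ).toPCTL.property = Φ.toPCTL.property ∩ Ψ.toPCTL.property := by
  ext T
  rw [Set.mem_inter_iff, Flat.mem_property_iff, Flat.mem_property_iff, Flat.mem_property_iff]
  rfl

theorem FlatAtom.mem_property_iff (φ : FlatAtom AP) (T : TotalTree AP) :
    T ∈ φ.toPCTL.property ↔ φ.HoldsIn T.1.prob T.1.label T.1.root :=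
  Flat.mem_property_iff (.prob φ) T

section Values

variable (q : unitInterval) (α β : Literal AP) (T : TotalTree AP)

theorem untilRoot_ne_top (A B : Set AP → Prop) : T.1.untilRoot A B ≠ ⊤ :=
  ne_top_of_le_ne_top ENNReal.one_ne_top
    ((T.1.untilRoot_le_weakUntilRoot A B).trans (T.1.weakUntilRoot_le_one A B))

theorem weakUntilRoot_ne_top (A B : Set AP → Prop) : T.1.weakUntilRoot A B ≠ ⊤ :=
  ne_top_of_le_ne_top ENNReal.one_ne_top (T.1.weakUntilRoot_le_one A B)

theorem mem_property_probU_le_iff :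
    T ∈ (FlatAtom.probU .le q α β).toPCTL.property ↔
      T.1.untilRoot (fun L => α.HoldsAt L) (fun L => β.HoldsAt L) ≤ ENNReal.ofReal q :=
  (FlatAtom.mem_property_iff _ T).trans (ENNReal.le_ofReal_iff_toReal_le
    (untilRoot_ne_top T (fun L => α.HoldsAt L) (fun L => β.HoldsAt L)) q.2.1).symm

theorem mem_property_probU_ge_iff :
    T ∈ (FlatAtom.probU .ge q α β).toPCTL.property ↔
      ENNReal.ofReal q ≤ T.1.untilRoot (fun L => α.HoldsAt L) (fun L => β.HoldsAt L) :=
  (FlatAtom.mem_property_iff _ T).trans (ENNReal.ofReal_le_iff_le_toReal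
    (untilRoot_ne_top T (fun L => α.HoldsAt L) (fun L => β.HoldsAt L))).symm

theorem mem_property_probW_le_iff :
    T ∈ (FlatAtom.probW .le q α β).toPCTL.property ↔
      T.1.weakUntilRoot (fun L => α.HoldsAt L) (fun L => β.HoldsAt L) ≤ ENNReal.ofReal q :=
  (FlatAtom.mem_property_iff _ T).trans (ENNReal.le_ofReal_iff_toReal_le
    (weakUntilRoot_ne_top T (fun L => α.HoldsAt L) (fun L => β.HoldsAt L)) q.2.1).symm

theorem mem_property_probW_ge_iff :
    T ∈ (FlatAtom.probW .ge q α β).toPCTL.property ↔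
      ENNReal.ofReal q ≤ T.1.weakUntilRoot (fun L => α.HoldsAt L) (fun L => β.HoldsAt L) :=
  (FlatAtom.mem_property_iff _ T).trans (ENNReal.ofReal_le_iff_le_toReal
    (weakUntilRoot_ne_top T (fun L => α.HoldsAt L) (fun L => β.HoldsAt L))).symm

end Values

/-! ### Closed formulas -/

theorem propertyClosure_literal (α : Literal AP) :
    propertyClosure α.toPCTL.property = α.toPCTL.property := by
  refine Set.Subset.antisymm (fun T hT => ?_) (subset_propertyClosure _)
  obtain ⟨T₂, h2, hp⟩ := (mem_propertyClosure_iff _ T).1 hT 0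
  rw [Literal.mem_property_iff] at h2 ⊢
  have hr := (T.1.cut 0).root_mem
  rwa [← (T.1.cut_isPrefix 0).root_eq, (T.1.cut_isPrefix 0).2.1 _ hr, ← hp.2.1 _ hr, hp.root_eq]

theorem propertyClosure_probX (b : Bound) (q : unitInterval) (α : Literal AP) :
    propertyClosure (FlatAtom.probX b q α).toPCTL.property =
      (FlatAtom.probX b q α).toPCTL.property := by
  refine Set.Subset.antisymm (fun T hT => ?_) (subset_propertyClosure _)
  obtain ⟨T₂, h2, hp⟩ := (mem_propertyClosure_iff _ T).1 hT 2
  rw [FlatAtom.mem_property_iff] at h2 ⊢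
  have := T.2.nextVal_root_eq hp (fun L => α.HoldsAt L)
  simp only [FlatAtom.HoldsIn] at h2 ⊢
  rwa [this]

/-- The value is a supremum of expansions from 0, each fixed by a cut, and in a tree with the
property each is at most q. -/
theorem propertyClosure_probU_le (q : unitInterval) (α β : Literal AP) :
    propertyClosure (FlatAtom.probU .le q α β).toPCTL.property =
      (FlatAtom.probU .le q α β).toPCTL.property := by
  refine Set.Subset.antisymm (fun T hT => ?_) (subset_propertyClosure _)
  rw [mem_property_probU_le_iff]
  refine iSup_le fun n => ?_
  cases n with
  | zero => exact zero_le
  | succ n =>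
    obtain ⟨T₂, h2, hp⟩ := (mem_propertyClosure_iff _ T).1 hT n
    rw [mem_property_probU_le_iff] at h2
    exact (T.2.iterate_step_root_eq T₂.2 hp _ _ 0).le.trans
      ((T₂.1.iterate_step_zero_le_untilRoot _ _ (n + 1)).trans h2)

/-- Dual: the value is an infimum of expansions from 1, each fixed by a cut. -/
theorem propertyClosure_probW_ge (q : unitInterval) (α β : Literal AP) :
    propertyClosure (FlatAtom.probW .ge q α β).toPCTL.property =
      (FlatAtom.probW .ge q α β).toPCTL.property := by
  refine Set.Subset.antisymm (fun T hT => ?_) (subset_propertyClosure _)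
  rw [mem_property_probW_ge_iff]
  refine le_iInf fun n => ?_
  cases n with
  | zero => exact ENNReal.ofReal_le_one.2 q.2.2
  | succ n =>
    obtain ⟨T₂, h2, hp⟩ := (mem_propertyClosure_iff _ T).1 hT n
    rw [mem_property_probW_ge_iff] at h2
    exact h2.trans ((T₂.1.weakUntilRoot_le_iterate_step_one _ _ (n + 1)).trans
      (T.2.iterate_step_root_eq T₂.2 hp _ _ 1).ge)

theorem propertyClosure_flatAtom_cls (φ : FlatAtom AP) :
    propertyClosure φ.cls.toPCTL.property = φ.cls.toPCTL.property := by
  rcases φ with ⟨b, q, α⟩ | ⟨_ | _, q, α, β⟩ | ⟨_ | _, q, α, β⟩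
  · exact propertyClosure_probX b q α
  · exact propertyClosure_probU_le q α β
  · exact propertyClosure_probW_ge q α β
  · exact propertyClosure_probU_le q α β
  · exact propertyClosure_probW_ge q α β

/-! ### Satisfaction of the closure formulas -/

theorem untilPaths_subset_weakUntilPaths {S : Type*} (A B : S → Prop) :
    untilPaths A B ⊆ weakUntilPaths A B :=
  fun _ h => Or.inl h

/-- Every path satisfying U satisfies W, so W for U under a lower bound and U for W under an upper
bound are weakenings. -/
theorem FlatAtom.sat_cls {S : Type*} {D : MarkovChain S AP} {s : S} {φ : FlatAtom AP}
    (h : φ.toPCTL.Sat D s) : φ.cls.toPCTL.Sat D s := by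
  rcases φ with ⟨b, q, α⟩ | ⟨_ | _, q, α, β⟩ | ⟨_ | _, q, α, β⟩
  · exact h
  · exact h
  · exact le_trans (b := D.pr s (untilPaths (α.toPCTL.Sat D) (β.toPCTL.Sat D))) h
      (D.pr_mono s (untilPaths_subset_weakUntilPaths _ _))
  · exact le_trans (b := D.pr s (weakUntilPaths (α.toPCTL.Sat D) (β.toPCTL.Sat D)))
      (D.pr_mono s (untilPaths_subset_weakUntilPaths _ _)) h
  · exact h

theorem weakUntilPaths_eq_univ {S : Type*} {A B : S → Prop} (h : ∀ s, A s ∨ B s) :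
    weakUntilPaths A B = Set.univ := by
  classical
  refine Set.eq_univ_of_forall fun π => ?_
  by_cases hA : ∀ i, A (π i)
  · exact Or.inr hA
  · push Not at hA
    refine Or.inl ⟨Nat.find hA, (h _).resolve_left (Nat.find_spec hA), fun k hk => ?_⟩
    exact not_not.1 (Nat.find_min hA hk)

theorem untilPaths_eq_empty {S : Type*} {A B : S → Prop} (h : ∀ s, ¬ B s) :
    untilPaths A B = ∅ :=
  Set.eq_empty_of_forall_notMem fun _ ⟨_, hB, _⟩ => h _ hB

theorem not_sat_probU_ge {S : Type*} (D : MarkovChain S AP) (s : S) {q : unitInterval}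
    (hq : q ≠ 0) (α : Literal AP) {β : Literal AP} (hβ : ¬ β.Satisfiable) :
    ¬ (FlatAtom.probU .ge q α β).toPCTL.Sat D s := by
  intro h
  have h1 : (q : ℝ) ≤ D.pr s (untilPaths (α.toPCTL.Sat D) (β.toPCTL.Sat D)) := h
  rw [untilPaths_eq_empty fun s hs => hβ ⟨_, (β.sat_toPCTL D s).1 hs⟩, D.pr_empty] at h1
  exact hq (Subtype.ext (le_antisymm h1 q.2.1))

theorem not_sat_probW_le {S : Type*} (D : MarkovChain S AP) (s : S) {q : unitInterval}
    (hq : q ≠ 1) {α β : Literal AP} (hαβ : ∀ A, α.HoldsAt A ∨ β.HoldsAt A) :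
    ¬ (FlatAtom.probW .le q α β).toPCTL.Sat D s := by
  intro h
  have h1 : D.pr s (weakUntilPaths (α.toPCTL.Sat D) (β.toPCTL.Sat D)) ≤ (q : ℝ) := h
  rw [Literal.sat_toPCTL_eq, Literal.sat_toPCTL_eq,
    weakUntilPaths_eq_univ fun s => hαβ (D.label s), D.pr_univ] at h1
  exact hq (Subtype.ext (le_antisymm q.2.2 h1))

/-- Provides an unsatisfiable atom that is not degenerate, as a substitute for the degenerate ones.
-/
theorem not_sat_probX_ge {S : Type*} (D : MarkovChain S AP) (s : S) {q : unitInterval}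
    (hq : q ≠ 0) {α : Literal AP} (hα : ¬ α.Satisfiable) :
    ¬ (FlatAtom.probX .ge q α).toPCTL.Sat D s := by
  intro h
  have h1 : (q : ℝ) ≤ D.pr s (nextPaths (α.toPCTL.Sat D)) := h
  have h2 : nextPaths (α.toPCTL.Sat D) = ∅ :=
    Set.eq_empty_of_forall_notMem fun π hπ => hα ⟨_, (α.sat_toPCTL D _).1 hπ⟩
  rw [h2, D.pr_empty] at h1
  exact hq (Subtype.ext (le_antisymm h1 q.2.1))

/-! ### Closures of the remaining formulas -/

theorem propertyClosure_flatAtom_subset (φ : FlatAtom AP) :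
    propertyClosure φ.toPCTL.property ⊆ φ.cls.toPCTL.property :=
  (propertyClosure_mono (PCTL.property_mono fun _ => FlatAtom.sat_cls)).trans
    (propertyClosure_flatAtom_cls φ).le

/-- The total tree obtained from `T.cut n` by continuing with the label `L` forever. -/
def cutExtend (T : ProbTree AP) (n : ℕ) (L : Set AP) : TotalTree AP :=
  ⟨(T.cut n).extend fun _ => L, (T.cut n).extend_isTotal _⟩

theorem cut_isPrefix_cutExtend (T : ProbTree AP) (n : ℕ) (L : Set AP) :
    (T.cut n).IsPrefix (cutExtend T n L).1 :=
  (T.cut n).isPrefix_extend _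

theorem cutExtend_label (T : ProbTree AP) (n : ℕ) (L : Set AP) {π : List ℕ}
    (hπ : π ∈ (cutExtend T n L).1.nodes) (hn : π.length = n + 2) :
    (cutExtend T n L).1.label π = L :=
  (T.cut n).extend_label _ hπ fun h => by
    have := h.2
    omega

theorem propertyClosure_probU_ge {q : unitInterval} {α β : Literal AP}
    (h : q = 0 ∨ β.Satisfiable ∨ ¬ α.Satisfiable) :
    propertyClosure (FlatAtom.probU .ge q α β).toPCTL.property =
      (FlatAtom.probW .ge q α β).toPCTL.property := by
  refine Set.Subset.antisymm (propertyClosure_flatAtom_subset (.probU .ge q α β)) fun T hT => ?_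
  rw [mem_property_probW_ge_iff] at hT
  rcases h with rfl | ⟨L, hL⟩ | hα
  · refine subset_propertyClosure _ ((mem_property_probU_ge_iff _ _ _ _).2 ?_)
    simp
  -- Continuing with a label that satisfies β makes every path not yet failed within the cut
  -- succeed.
  · refine (mem_propertyClosure_iff _ T).2 fun n =>
      ⟨cutExtend T.1 n L, ?_, cut_isPrefix_cutExtend T.1 n L⟩
    rw [mem_property_probU_ge_iff]
    refine hT.trans ((T.1.weakUntilRoot_le_iterate_step_one _ _ (n + 1)).trans ?_)
    rw [T.2.iterate_step_root_eq (cutExtend T.1 n L).2 (cut_isPrefix_cutExtend T.1 n L)]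
    refine (cutExtend T.1 n L).1.iterate_step_one_le_untilRoot _ _ n fun π hπ hn => ?_
    rwa [cutExtend_label _ _ _ hπ hn]
  -- If α never holds, the root alone decides, and U and W have the same value in `T` itself.
  · refine subset_propertyClosure _ ((mem_property_probU_ge_iff _ _ _ _).2 (hT.trans ?_))
    exact T.1.weakUntilRoot_le_untilRoot _ _ 0 fun π _ _ => Or.inr fun h => hα ⟨_, h⟩

theorem propertyClosure_probW_le {q : unitInterval} {α β : Literal AP}
    (h : q = 1 ∨ ((Literal.neg α).and (Literal.neg β)).Satisfiable ∨ β.Valid) :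
    propertyClosure (FlatAtom.probW .le q α β).toPCTL.property =
      (FlatAtom.probU .le q α β).toPCTL.property := by
  refine Set.Subset.antisymm (propertyClosure_flatAtom_subset (.probW .le q α β)) fun T hT => ?_
  rw [mem_property_probU_le_iff] at hT
  rcases h with rfl | ⟨L, hL⟩ | hβ
  · refine subset_propertyClosure _ ((mem_property_probW_le_iff _ _ _ _).2 ?_)
    simpa using T.1.weakUntilRoot_le_one _ _
  -- Continuing with a label that violates α and β makes every path not yet successful within the
  -- cut fail.
  · refine (mem_propertyClosure_iff _ T).2 fun n =>
      ⟨cutExtend T.1 n L, ?_, cut_isPrefix_cutExtend T.1 n L⟩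
    rw [mem_property_probW_le_iff]
    refine le_trans ?_ ((T.1.iterate_step_zero_le_untilRoot _ _ (n + 1)).trans hT)
    rw [T.2.iterate_step_root_eq (cutExtend T.1 n L).2 (cut_isPrefix_cutExtend T.1 n L)]
    refine (cutExtend T.1 n L).1.weakUntilRoot_le_iterate_step_zero _ _ n fun π hπ hn => ?_
    rwa [cutExtend_label _ _ _ hπ hn]
  · refine subset_propertyClosure _ ((mem_property_probW_le_iff _ _ _ _).2 (le_trans ?_ hT))
    exact T.1.weakUntilRoot_le_untilRoot _ _ 0 fun π _ _ => Or.inl (hβ _)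

theorem exists_propertyClosure_flatAtom_eq (φ : FlatAtom AP) : ∃ ψ : FlatAtom AP,
    propertyClosure φ.toPCTL.property = ψ.toPCTL.property := by
  -- Outside the side conditions the formula is unsatisfiable, and the empty property is its own
  -- closure.
  have hempty : (∀ D : MarkovChain ℕ AP, ¬ φ.toPCTL.Sat D D.init) →
      propertyClosure φ.toPCTL.property = φ.toPCTL.property := by
    intro h
    have : φ.toPCTL.property = ∅ :=
      Set.eq_empty_of_forall_notMem fun T ⟨D, hD, _⟩ => h D hD
    rw [this, propertyClosure_empty]
  rcases φ with ⟨b, q, α⟩ | ⟨_ | _, q, α, β⟩ | ⟨_ | _, q, α, β⟩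
  · exact ⟨_, propertyClosure_probX b q α⟩
  · exact ⟨_, propertyClosure_probU_le q α β⟩
  · by_cases h : q = 0 ∨ β.Satisfiable ∨ ¬ α.Satisfiable
    · exact ⟨_, propertyClosure_probU_ge h⟩
    · push Not at h
      exact ⟨_, hempty fun D => not_sat_probU_ge D _ h.1 α h.2.1⟩
  · by_cases h : q = 1 ∨ ((Literal.neg α).and (Literal.neg β)).Satisfiable ∨ β.Valid
    · exact ⟨_, propertyClosure_probW_le h⟩
    · push Not at h
      refine ⟨_, hempty fun D => not_sat_probW_le D _ h.1 fun A => ?_⟩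
      by_contra hA
      exact h.2.1 ⟨A, not_or.1 hA⟩
  · exact ⟨_, propertyClosure_probW_ge q α β⟩

theorem exists_propertyClosure_clause_eq (Γ : Clause AP) : ∃ Δ : Clause AP,
    propertyClosure Γ.toFlat.toPCTL.property = Δ.toFlat.toPCTL.property := by
  induction Γ with
  | prob φ =>
    obtain ⟨ψ, h⟩ := exists_propertyClosure_flatAtom_eq φ
    exact ⟨.prob ψ, h⟩
  | or Γ Δ ihΓ ihΔ =>
    obtain ⟨Γ', hΓ⟩ := ihΓ
    obtain ⟨Δ', hΔ⟩ := ihΔ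
    refine ⟨.or Γ' Δ', ?_⟩
    change propertyClosure (PCTL.or _ _).property = (PCTL.or _ _).property
    rw [PCTL.property_or, PCTL.property_or, propertyClosure_union, hΓ, hΔ]

/-! ### The decomposition algorithm -/

theorem propertyClosure_clause_cls (Γ : Clause AP) :
    propertyClosure Γ.cls.toFlat.toPCTL.property = Γ.cls.toFlat.toPCTL.property := by
  induction Γ with
  | prob φ => exact propertyClosure_flatAtom_cls φ
  | or Γ Δ ihΓ ihΔ =>
    change propertyClosure (PCTL.or _ _).property = (PCTL.or _ _).property
    rw [PCTL.property_or, propertyClosure_union, ihΓ, ihΔ]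

theorem propertyClosure_safePart (Θ : ClauseConj AP) :
    propertyClosure Θ.safePart.toPCTL.property = Θ.safePart.toPCTL.property := by
  induction Θ with
  | single Γ => exact propertyClosure_clause_cls Γ
  | and Θ Ξ ihΘ ihΞ =>
    rw [ClauseConj.safePart, Flat.property_and]
    exact propertyClosure_inter_eq ihΘ ihΞ

theorem Clause.sat_cls {S : Type*} {D : MarkovChain S AP} {s : S} {Γ : Clause AP}
    (h : Γ.toFlat.toPCTL.Sat D s) : Γ.cls.toFlat.toPCTL.Sat D s := by
  induction Γ with
  | prob φ => exact FlatAtom.sat_cls h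
  | or Γ Δ ihΓ ihΔ =>
    exact (PCTL.sat_or D _ _ s).2 (((PCTL.sat_or D _ _ s).1 h).imp ihΓ ihΔ)

section

variable {S : Type*} (D : MarkovChain S AP) (s : S)

theorem ClauseConj.sat_orClause (Θ : ClauseConj AP) (Δ : Clause AP) :
    (Θ.orClause Δ).toFlat.toPCTL.Sat D s ↔
      Θ.toFlat.toPCTL.Sat D s ∨ Δ.toFlat.toPCTL.Sat D s := by
  induction Θ with
  | single Γ => exact PCTL.sat_or D _ _ s
  | and Θ Ξ ihΘ ihΞ => exact (and_congr ihΘ ihΞ).trans and_or_right.symm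

theorem ClauseConj.sat_distribute (Θ Ξ : ClauseConj AP) :
    (Θ.distribute Ξ).toFlat.toPCTL.Sat D s ↔
      Θ.toFlat.toPCTL.Sat D s ∨ Ξ.toFlat.toPCTL.Sat D s := by
  induction Ξ with
  | single Δ => exact Θ.sat_orClause D s Δ
  | and Ξ Ξ' ih ih' => exact (and_congr ih ih').trans or_and_left.symm

theorem Flat.sat_toClauses (Φ : Flat AP) :
    Φ.toClauses.toFlat.toPCTL.Sat D s ↔ Φ.toPCTL.Sat D s := by
  induction Φ with
  | prob φ => rfl
  | and Φ Ψ ihΦ ihΨ => exact and_congr ihΦ ihΨ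
  | or Φ Ψ ihΦ ihΨ =>
    exact (ClauseConj.sat_distribute D s _ _).trans
      ((or_congr ihΦ ihΨ).trans (PCTL.sat_or D _ _ s).symm)

theorem ClauseConj.sat_livePart_single (Γ : Clause AP) :
    (single Γ).livePart.Sat D s ↔
      (Γ.cls.toFlat.toPCTL.Sat D s → Γ.toFlat.toPCTL.Sat D s) := by
  refine (PCTL.sat_or D _ _ s).trans ?_
  change _ ∨ ¬ _ ↔ _
  tauto

/-- Each live conjunct is the implication from the closure formula back to the clause; the converse
implication is `Clause.sat_cls`. -/
theorem ClauseConj.sat_iff_safePart_and_livePart (Θ : ClauseConj AP) :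
    Θ.toFlat.toPCTL.Sat D s ↔ Θ.safePart.toPCTL.Sat D s ∧ Θ.livePart.Sat D s := by
  induction Θ with
  | single Γ =>
    rw [sat_livePart_single]
    exact ⟨fun h => ⟨Clause.sat_cls h, fun _ => h⟩, fun h => h.2 h.1⟩
  | and Θ Ξ ihΘ ihΞ => exact (and_congr ihΘ ihΞ).trans and_and_and_comm

end

theorem equivalent_decompose (Φ : Flat AP) :
    Φ.toPCTL.Equivalent ((decompose Φ).1.toPCTL.and (decompose Φ).2) := by
  intro S _ D
  exact (Φ.sat_toClauses D D.init).symm.trans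
    (Φ.toClauses.sat_iff_safePart_and_livePart D D.init)

theorem isSafe_decompose (Φ : Flat AP) : IsSafe (decompose Φ).1.toPCTL.property :=
  isSafe_of_propertyClosure_eq (propertyClosure_safePart Φ.toClauses)

/-! ### Liveness -/

theorem ClauseConj.nondegenerate_orClause {Θ : ClauseConj AP} {Δ : Clause AP}
    (hΘ : Θ.toFlat.Nondegenerate) (hΔ : Δ.toFlat.Nondegenerate) :
    (Θ.orClause Δ).toFlat.Nondegenerate := by
  induction Θ with
  | single Γ => exact ⟨hΘ, hΔ⟩
  | and Θ Ξ ihΘ ihΞ => exact ⟨ihΘ hΘ.1, ihΞ hΘ.2⟩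

theorem ClauseConj.nondegenerate_distribute {Θ Ξ : ClauseConj AP}
    (hΘ : Θ.toFlat.Nondegenerate) (hΞ : Ξ.toFlat.Nondegenerate) :
    (Θ.distribute Ξ).toFlat.Nondegenerate := by
  induction Ξ with
  | single Δ => exact nondegenerate_orClause hΘ hΞ
  | and Ξ Ξ' ih ih' => exact ⟨ih hΞ.1, ih' hΞ.2⟩

theorem Flat.Nondegenerate.toClauses {Φ : Flat AP} (h : Φ.Nondegenerate) :
    Φ.toClauses.toFlat.Nondegenerate := by
  induction Φ with
  | prob φ => exact h
  | and Φ Ψ ihΦ ihΨ => exact ⟨ihΦ h.1, ihΨ h.2⟩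
  | or Φ Ψ ihΦ ihΨ => exact ClauseConj.nondegenerate_distribute (ihΦ h.1) (ihΨ h.2)

theorem Clause.sat_of_sat_cls {S : Type*} {D : MarkovChain S AP} {s : S}
    (hD : ∀ φ : FlatAtom AP, φ.Nondegenerate → φ.cls.toPCTL.Sat D s → φ.toPCTL.Sat D s)
    {Γ : Clause AP} (hΓ : Γ.toFlat.Nondegenerate) (h : Γ.cls.toFlat.toPCTL.Sat D s) :
    Γ.toFlat.toPCTL.Sat D s := by
  induction Γ with
  | prob φ => exact hD φ hΓ h
  | or Γ Δ ihΓ ihΔ =>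
    exact (PCTL.sat_or D _ _ s).2 (((PCTL.sat_or D _ _ s).1 h).imp (ihΓ hΓ.1) (ihΔ hΓ.2))

/-- Live properties are not closed under intersection, so a single chain has to serve all atoms, as
`hD` demands. -/
theorem ClauseConj.sat_livePart {S : Type*} {D : MarkovChain S AP} {s : S}
    (hD : ∀ φ : FlatAtom AP, φ.Nondegenerate → φ.cls.toPCTL.Sat D s → φ.toPCTL.Sat D s)
    {Θ : ClauseConj AP} (hΘ : Θ.toFlat.Nondegenerate) : Θ.livePart.Sat D s := by
  induction Θ with
  | single Γ => exact (sat_livePart_single D s Γ).2 (Clause.sat_of_sat_cls hD hΘ)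
  | and Θ Ξ ihΘ ihΞ => exact ⟨ihΘ hΘ.1, ihΞ hΘ.2⟩

/-- Every tree of finite depth is a prefix of a total tree in which nondegenerate formulas
`P_{⋈ q}(φ)` are equivalent to their closure formulas, because each of its paths eventually
visits all labels. -/
theorem exists_isPrefix_property_cls_subset [Finite AP] {T₁ : ProbTree AP}
    (hT₁ : T₁.IsFiniteDepth) :
    ∃ T₂ : TotalTree AP, T₁.IsPrefix T₂.1 ∧ ∀ φ : FlatAtom AP, φ.Nondegenerate →
      T₂ ∈ φ.cls.toPCTL.property → T₂ ∈ φ.toPCTL.property := by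
  obtain ⟨N, hN⟩ := hT₁
  obtain ⟨e, he⟩ := exists_surjective_nat (Set AP)
  -- The enumeration of labels starts at length N + 1, beyond all nodes of `T₁`, so all nodes of
  -- such a length share one label. Shorter new nodes get `e 0` by truncated subtraction, which is
  -- harmless.
  let T₂ : TotalTree AP := ⟨T₁.extend fun n => e (n - (N + 1)), T₁.extend_isTotal _⟩
  have hvisit : ∀ L : Set AP, ∃ n, ∀ π ∈ T₂.1.nodes, π.length = n + 1 → T₂.1.label π = L := by
    intro L
    obtain ⟨i, rfl⟩ := he L
    refine ⟨N + i, fun π hπ hn => ?_⟩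
    have hmem : π ∉ T₁.nodes := fun h => by
      have := hN π h
      omega
    refine (T₁.extend_label _ hπ hmem).trans ?_
    rw [hn]
    congr 1
    omega
  have key : ∀ α β : Literal AP, ¬ α.Valid ∨ β.Satisfiable →
      T₂.1.weakUntilRoot (fun L => α.HoldsAt L) (fun L => β.HoldsAt L) ≤
        T₂.1.untilRoot (fun L => α.HoldsAt L) (fun L => β.HoldsAt L) := by
    intro α β h
    have hL : ∃ L, β.HoldsAt L ∨ ¬ α.HoldsAt L := by
      rcases h with h | ⟨L, hL⟩
      · obtain ⟨L, hL⟩ := not_forall.1 h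
        exact ⟨L, Or.inr hL⟩
      · exact ⟨L, Or.inl hL⟩
    obtain ⟨L, hL⟩ := hL
    obtain ⟨n, hn⟩ := hvisit L
    refine T₂.1.weakUntilRoot_le_untilRoot _ _ n fun π hπ hl => ?_
    rwa [hn π hπ hl]
  refine ⟨T₂, T₁.isPrefix_extend _, fun φ hφ h => ?_⟩
  rcases φ with ⟨b, q, α⟩ | ⟨_ | _, q, α, β⟩ | ⟨_ | _, q, α, β⟩
  · exact h
  · exact h
  · rcases hφ with rfl | hφ
    · rw [mem_property_probU_ge_iff]
      simp
    · exact (mem_property_probU_ge_iff _ _ _ _).2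
        (((mem_property_probW_ge_iff _ _ _ _).1 h).trans (key α β hφ))
  · rcases hφ with rfl | hφ
    · rw [mem_property_probW_le_iff]
      simpa using T₂.1.weakUntilRoot_le_one _ _
    · exact (mem_property_probW_le_iff _ _ _ _).2
        ((key α β hφ).trans ((mem_property_probU_le_iff _ _ _ _).1 h))
  · exact h

theorem isLive_decompose [Finite AP] {Φ : Flat AP} (hΦ : Φ.Nondegenerate) :
    IsLive (decompose Φ).2.property := by
  intro T₁ hT₁
  obtain ⟨T₂, hp, h⟩ := exists_isPrefix_property_cls_subset hT₁
  have hi := T₂.1.isomorphic_unfolding_toMarkovChain T₂.2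
  refine ⟨T₂, ⟨_, ClauseConj.sat_livePart (fun φ hφ hs => ?_) hΦ.toClauses, hi⟩, hp⟩
  exact (hi.flat_holdsIn_iff (.prob φ)).1
    ((FlatAtom.mem_property_iff φ T₂).1 (h φ hφ ⟨_, hs, hi⟩))

/-- A degenerate atom is unsatisfiable and can be exchanged for `P_{≥ 1}(X (a ∧ ¬ a))`; an atomic
proposition is needed to express falsity. -/
theorem exists_nondegenerate_flatAtom [Nonempty AP] (φ : FlatAtom AP) :
    ∃ ψ : FlatAtom AP, ψ.Nondegenerate ∧
      ∀ (S : Type) (D : MarkovChain S AP) (s : S), φ.toPCTL.Sat D s ↔ ψ.toPCTL.Sat D s := by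
  by_cases hφ : φ.Nondegenerate
  · exact ⟨φ, hφ, fun _ _ _ => Iff.rfl⟩
  obtain ⟨a⟩ := ‹Nonempty AP›
  have hfalse : ¬ ((Literal.atom a).and (Literal.neg (Literal.atom a))).Satisfiable :=
    fun ⟨_, h⟩ => h.2 h.1
  refine ⟨.probX .ge 1 ((Literal.atom a).and (Literal.neg (Literal.atom a))), trivial,
    fun S D s => iff_of_false ?_ (not_sat_probX_ge D s one_ne_zero hfalse)⟩
  rcases φ with ⟨b, q, α⟩ | ⟨_ | _, q, α, β⟩ | ⟨_ | _, q, α, β⟩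
  · exact absurd trivial hφ
  · exact absurd trivial hφ
  · obtain ⟨hq, hφ⟩ := not_or.1 hφ
    exact not_sat_probU_ge D s hq α (not_or.1 hφ).2
  · obtain ⟨hq, hφ⟩ := not_or.1 hφ
    exact not_sat_probW_le D s hq fun A => Or.inl (not_not.1 (not_or.1 hφ).1 A)
  · exact absurd trivial hφ

theorem exists_nondegenerate_flat [Nonempty AP] (Φ : Flat AP) :
    ∃ Ψ : Flat AP, Ψ.Nondegenerate ∧
      ∀ (S : Type) (D : MarkovChain S AP) (s : S), Φ.toPCTL.Sat D s ↔ Ψ.toPCTL.Sat D s := by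
  induction Φ with
  | prob φ =>
    obtain ⟨ψ, h⟩ := exists_nondegenerate_flatAtom φ
    exact ⟨.prob ψ, h⟩
  | and Φ Ψ ihΦ ihΨ =>
    obtain ⟨Φ', h1, h2⟩ := ihΦ
    obtain ⟨Ψ', h3, h4⟩ := ihΨ
    exact ⟨.and Φ' Ψ', ⟨h1, h3⟩, fun S D s => and_congr (h2 S D s) (h4 S D s)⟩
  | or Φ Ψ ihΦ ihΨ =>
    obtain ⟨Φ', h1, h2⟩ := ihΦ
    obtain ⟨Ψ', h3, h4⟩ := ihΨ
    exact ⟨.or Φ' Ψ', ⟨h1, h3⟩, fun S D s => (PCTL.sat_or D _ _ s).trans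
      ((or_congr (h2 S D s) (h4 S D s)).trans (PCTL.sat_or D _ _ s).symm)⟩

end

end ProbLogic

/-- Closure formulas of flat PCTL and correctness of the decomposition algorithm. -/
theorem mainTheorem4 {AP : Type} [Finite AP] [Nonempty AP] :
    -- the closure formulas of the conjunction-free flat formulas
    ((∀ α : Literal AP,
        propertyClosure α.toPCTL.property = α.toPCTL.property) ∧
      (∀ (b : Bound) (q : unitInterval) (α : Literal AP),
        propertyClosure (FlatAtom.probX b q α).toPCTL.property =
          (FlatAtom.probX b q α).toPCTL.property) ∧
      (∀ (q : unitInterval) (α β : Literal AP),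
        propertyClosure (FlatAtom.probU .le q α β).toPCTL.property =
          (FlatAtom.probU .le q α β).toPCTL.property) ∧
      (∀ (q : unitInterval) (α β : Literal AP),
        q = 0 ∨ β.Satisfiable ∨ ¬ α.Satisfiable →
        propertyClosure (FlatAtom.probU .ge q α β).toPCTL.property =
          (FlatAtom.probW .ge q α β).toPCTL.property) ∧
      (∀ (q : unitInterval) (α β : Literal AP),
        propertyClosure (FlatAtom.probW .ge q α β).toPCTL.property =
          (FlatAtom.probW .ge q α β).toPCTL.property) ∧
      (∀ (q : unitInterval) (α β : Literal AP),
        q = 1 ∨ ((Literal.neg α).and (Literal.neg β)).Satisfiable ∨ β.Valid →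
        propertyClosure (FlatAtom.probW .le q α β).toPCTL.property =
          (FlatAtom.probU .le q α β).toPCTL.property) ∧
      (∀ Φ Ψ : PCTL AP,
        propertyClosure (Φ.or Ψ).property =
          propertyClosure Φ.property ∪ propertyClosure Ψ.property)) ∧
    -- the closure of every conjunction-free flat formula is such a formula again
    (∀ Γ : Clause AP, ∃ Δ : Clause AP,
      propertyClosure Γ.toFlat.toPCTL.property = Δ.toFlat.toPCTL.property) ∧
    -- correctness of the algorithm
    (∀ Φ : Flat AP,
      Φ.toPCTL.Equivalent ((decompose Φ).1.toPCTL.and (decompose Φ).2) ∧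
      IsSafe (decompose Φ).1.toPCTL.property ∧
      (Φ.Nondegenerate → IsLive (decompose Φ).2.property)) ∧
    -- every flat formula has such a decomposition
    (∀ Φ : Flat AP, ∃ (Φs : Flat AP) (Φl : PCTL AP),
      Φ.toPCTL.Equivalent (Φs.toPCTL.and Φl) ∧
      IsSafe Φs.toPCTL.property ∧ IsLive Φl.property) := by
  refine ⟨⟨propertyClosure_literal, propertyClosure_probX, propertyClosure_probU_le,
    fun _ _ _ => propertyClosure_probU_ge, propertyClosure_probW_ge,
    fun _ _ _ => propertyClosure_probW_le, fun Φ Ψ => ?_⟩, exists_propertyClosure_clause_eq,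
    fun Φ => ⟨equivalent_decompose Φ, isSafe_decompose Φ, isLive_decompose⟩, fun Φ => ?_⟩
  · rw [PCTL.property_or, propertyClosure_union]
  -- The algorithm is run on an equivalent formula without degenerate atoms, since its live part for
  -- Φ itself need not be live.
  · obtain ⟨Ψ, hΨ, h⟩ := exists_nondegenerate_flat Φ
    exact ⟨(decompose Ψ).1, (decompose Ψ).2,
      fun S _ D => (h S D D.init).trans (equivalent_decompose Ψ S D), isSafe_decompose Ψ,
      isLive_decompose hΨ⟩
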